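/- **Theorem 3.1.** Let $\mathbb S^1=\mathbb R/\mathbb Z$ with its standard (positively oriented) cyclic order. A *cyclic order* on a set $X$ is a function $c:X^3\to\{0,\pm1\}$ such that $c(x_1,x_2,x_3)=0$ if and only if $x_i=x_j$ for some $i\ne j$, and $c(x_2,x_3,x_4)-c(x_1,x_3,x_4)+c(x_1,x_2,x_4)-c(x_1,x_2,x_3)=0$ for all $x_1,\dots,x_4\in X$; a map $f:(X,c_X)\to(Y,c_Y)$ is *cyclic-order-preserving* if $c_Y(f(x_1),f(x_2),f(x_3))=c_X(x_1,x_2,x_3)$ for all $x_1,x_2,x_3\in X$. $\mathrm{Diff}^1_+(\mathbb S^1)$ denotes the group of orientation-preserving $C^1$ diffeomorphisms of $\mathbb S^1$, and $Df:\mathbb S^1\to(0,\infty)$ the derivative of $f\in\mathrm{Diff}^1_+(\mathbb S^1)$. Let $G$ be a countable group and let $(X,c)$ be a non-empty countable cyclically ordered set on which $G$ acts by cyclic-order-preserving maps. Assume that $X$ has subexponential growth of orbits: for every non-empty finite subset $S\subset G$ and every $x\in X$, $$\lim_{n\to\infty}|S^n x|^{1/n}=1,$$ where $S^n$ is the set of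 products of $n$ elements of $S$. Then there exist a homomorphism $\rho:G\to\mathrm{Diff}^1_+(\mathbb S^1)$ and a family $(J_x)_{x\in X}$ of open intervals in $\mathbb S^1$ (images of intervals $(a,b)\subset\mathbb R$ with $a<b\le a+1$, so the complement of a point is allowed) such that: 1. if $x\neq y$, then $J_x\cap J_y=\emptyset$, and $\bigcup_{x\in X}J_x$ is dense in $\mathbb S^1$; 2. the map $X\to\mathbb S^1$ that sends $x$ to the left endpoint of $J_x$ is cyclic-order-preserving, and so is the map that sends $x$ to the right endpoint of $J_x$; 3. $\rho(g)(J_x)=J_{gx}$ for all $g\in G$ and $x\in X$, and if $gx=x$ then $\rho(g)$ is the identity on $J_x$. Furthermore, for every finite subset $S\subset G$ and every $\varepsilon>0$, there exist such $\rho$ and $(J_x)_{x\in X}$ for which, in addition, $\sup_{\xi\in\mathbb S^1}|D\rho(s)(\xi)-1|<\varepsilon$ for every $s\in S$. -/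

import Mathlib

open scoped Pointwise Topology

/-- A cyclic (circular) order on `X`: a cocycle with values in `{-1, 0, 1}` vanishing exactly on
degenerate triples. -/
structure CyclicOrder (X : Type*) where
  /-- The orientation of a triple. -/
  c : X → X → X → SignType
  eq_zero_iff : ∀ x₁ x₂ x₃, c x₁ x₂ x₃ = 0 ↔ x₁ = x₂ ∨ x₂ = x₃ ∨ x₁ = x₃
  cocycle : ∀ x₁ x₂ x₃ x₄,
    (c x₂ x₃ x₄ : ℤ) - (c x₁ x₃ x₄ : ℤ) + (c x₁ x₂ x₄ : ℤ) - (c x₁ x₂ x₃ : ℤ) = 0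

/-- A map is cyclic-order-preserving if it preserves the orientation of every triple. -/
def CyclicOrder.Preserves {X Y : Type*} (cX : CyclicOrder X) (cY : CyclicOrder Y)
    (f : X → Y) : Prop :=
  ∀ x₁ x₂ x₃, cY.c (f x₁) (f x₂) (f x₃) = cX.c x₁ x₂ x₃

theorem sbtw_or_sbtw_iff_distinct {X : Type*} [CircularOrder X] (x y z : X) :
    sbtw x y z ∨ sbtw z y x ↔ ¬ (x = y ∨ y = z ∨ x = z) := by
  constructor
  · rintro (h | h) (rfl | rfl | rfl)
    · exact sbtw_irrefl_left h
    · exact sbtw_irrefl_right h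
    · exact sbtw_irrefl_left_right h
    · exact sbtw_irrefl_right h
    · exact sbtw_irrefl_left h
    · exact sbtw_irrefl_left_right h
  · intro h
    by_contra! hc
    rw [sbtw_iff_not_btw, sbtw_iff_not_btw, not_not, not_not] at hc
    have := btw_antisymm hc.1 hc.2
    grind

open Classical in
/-- Mathlib's circular orders are cyclic orders: a triple is positive if it is strictly
in order, and negative if the reversed triple is. -/
noncomputable def CyclicOrder.ofCircularOrder (X : Type*) [CircularOrder X] : CyclicOrder X where
  c x y z := if sbtw x y z then 1 else if sbtw z y x then -1 else 0
  eq_zero_iff x y z := by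
    have h := sbtw_or_sbtw_iff_distinct x y z
    split_ifs <;> simp <;> tauto
  cocycle x y z w := by
    have cyc : ∀ {a b c : X}, sbtw a b c → sbtw b c a := sbtw_cyclic_left
    have asy : ∀ {a b c : X}, sbtw a b c → ¬ sbtw c b a := sbtw_asymm
    have tr : ∀ {a b c d : X}, sbtw a b c → sbtw b d c → sbtw a d c := sbtw_trans_left
    have tot := fun a b c : X => sbtw_or_sbtw_iff_distinct a b c
    have h1 := tot y z w
    have h2 := tot x z w
    have h3 := tot x y w
    have h4 := tot x y z
    split_ifs <;> simp <;> grind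

/-- The circle `ℝ/ℤ` with its standard (positive) cyclic order. -/
noncomputable def circleCyclicOrder : CyclicOrder UnitAddCircle :=
  CyclicOrder.ofCircularOrder UnitAddCircle

/-- `D` is the derivative of the map `f : ℝ/ℤ → ℝ/ℤ`: some lift `F : ℝ → ℝ` of `f` to the
universal cover is differentiable with derivative `D (t mod ℤ)` at every `t`. -/
def HasCircleDeriv (f : UnitAddCircle → UnitAddCircle) (D : UnitAddCircle → ℝ) : Prop :=
  ∃ F : ℝ → ℝ, (∀ t : ℝ, (F t : UnitAddCircle) = f t) ∧
    ∀ t : ℝ, HasDerivAt F (D t) t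

/-- The derivative of a map of the circle does not depend on the lift. -/
theorem HasCircleDeriv.unique {f : UnitAddCircle → UnitAddCircle} {D E : UnitAddCircle → ℝ}
    (hD : HasCircleDeriv f D) (hE : HasCircleDeriv f E) : D = E := by
  obtain ⟨F, hF, hF'⟩ := hD
  obtain ⟨H, hH, hH'⟩ := hE
  funext ξ
  induction ξ using QuotientAddGroup.induction_on with
  | H t =>
    have hd := (hF' t).sub (hH' t)
    have hint : ∀ s, ∃ n : ℤ, (F - H) s = n := by
      intro s
      have h0 : ((F s - H s : ℝ) : UnitAddCircle) = 0 := by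
        rw [AddCircle.coe_sub, hF, hH, sub_self]
      obtain ⟨n, hn⟩ := (AddCircle.coe_eq_zero_iff (1 : ℝ)).1 h0
      exact ⟨n, by simpa using hn.symm⟩
    have hev : (F - H) =ᶠ[𝓝 t] fun _ => (F - H) t := by
      filter_upwards [hd.continuousAt.eventually (Metric.ball_mem_nhds _ one_pos)] with s hs
      obtain ⟨m, hm⟩ := hint s
      obtain ⟨n, hn⟩ := hint t
      rw [Real.dist_eq, hm, hn] at hs
      have hmn : |m - n| < 1 := by exact_mod_cast hs
      rw [hm, hn, sub_eq_zero.1 (Int.abs_lt_one_iff.1 hmn)]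
    have h0 := hd.unique ((hasDerivAt_const t ((F - H) t)).congr_of_eventuallyEq hev)
    exact sub_eq_zero.1 h0

/-- `f : ℝ/ℤ → ℝ/ℤ` is of class `C¹` with positive derivative. -/
def IsC1Pos (f : UnitAddCircle → UnitAddCircle) : Prop :=
  ∃ D : UnitAddCircle → ℝ, HasCircleDeriv f D ∧ Continuous D ∧ ∀ ξ, 0 < D ξ

theorem IsC1Pos.id : IsC1Pos (fun ξ => ξ) :=
  ⟨fun _ => 1, ⟨fun t => t, fun _ => rfl, fun t => hasDerivAt_id t⟩, continuous_const,
    fun _ => one_pos⟩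

theorem IsC1Pos.comp {f g : UnitAddCircle → UnitAddCircle} (hf : IsC1Pos f) (hg : IsC1Pos g)
    (hc : Continuous g) : IsC1Pos (fun ξ => f (g ξ)) := by
  obtain ⟨D, ⟨F, hF, hF'⟩, hD, hD'⟩ := hf
  obtain ⟨E, ⟨H, hH, hH'⟩, hE, hE'⟩ := hg
  refine ⟨fun ξ => D (g ξ) * E ξ, ⟨fun t => F (H t), fun t => by rw [hF, hH], fun t => ?_⟩,
    (hD.comp hc).mul hE, fun ξ => mul_pos (hD' _) (hE' _)⟩
  have := (hF' (H t)).comp t (hH' t)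
  rwa [hH] at this

/-- `Diff¹₊(S¹)`: the group of orientation-preserving `C¹` diffeomorphisms of `S¹ = ℝ/ℤ`, that is,
of homeomorphisms that are of class `C¹` with positive derivative, and whose inverse is too. -/
def DiffC1Plus : Subgroup (UnitAddCircle ≃ₜ UnitAddCircle) where
  carrier := {f | IsC1Pos f ∧ IsC1Pos f.symm}
  one_mem' := ⟨IsC1Pos.id, IsC1Pos.id⟩
  mul_mem' {f g} hf hg := ⟨hf.1.comp hg.1 g.continuous, hg.2.comp hf.2 f.symm.continuous⟩
  inv_mem' {_} hf := ⟨hf.2, hf.1⟩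

/-- The derivative `Df : S¹ → ℝ` of `f ∈ Diff¹₊(S¹)`. -/
noncomputable def DiffC1Plus.D (f : DiffC1Plus) : UnitAddCircle → ℝ :=
  f.2.1.choose

theorem DiffC1Plus.hasCircleDeriv (f : DiffC1Plus) :
    HasCircleDeriv f.1 (DiffC1Plus.D f) :=
  f.2.1.choose_spec.1

/-- The open interval of `ℝ/ℤ` running in the positive direction from `a mod ℤ` to `b mod ℤ`. It is
used for `a < b ≤ a + 1`; if `b = a + 1` it is the complement of a point. -/
def circleIoo (a b : ℝ) : Set UnitAddCircle :=
  (fun t : ℝ => (t : UnitAddCircle)) '' Set.Ioo a b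

/-- Subexponential growth of orbits: `|Sⁿ x|^(1/n) → 1` for all `x` and all finite `S ⊆ G`. Here
`Sⁿ` is the set of products of `n` elements of `S`, and `S` is nonempty (otherwise `Sⁿ x` is empty
for `n ≥ 1`). -/
def SubexpOrbitGrowth (G X : Type*) [Group G] [MulAction G X] : Prop :=
  ∀ S : Finset G, S.Nonempty → ∀ x : X,
    Filter.Tendsto
      (fun n : ℕ => (Set.ncard ((fun g : G => g • x) '' ((S : Set G) ^ n)) : ℝ) ^ (1 / (n : ℝ)))
      Filter.atTop (𝓝 1)

/-- The action `ρ` on the circle realises the cyclically ordered `G`-set `(X, c)` through the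
intervals `J x` with left endpoints `a x` and right endpoints `b x`. -/
structure IsRealisation {G X : Type*} [Group G] [MulAction G X] (c : CyclicOrder X)
    (ρ : G →* DiffC1Plus) (a b : X → ℝ) (J : X → Set UnitAddCircle) : Prop where
  lt : ∀ x, a x < b x
  le_add_one : ∀ x, b x ≤ a x + 1
  eq_Ioo : ∀ x, J x = circleIoo (a x) (b x)
  disjoint : ∀ x y, x ≠ y → J x ∩ J y = ∅
  dense : Dense (⋃ x, J x)
  left : c.Preserves circleCyclicOrder (fun x => (a x : UnitAddCircle))
  right : c.Preserves circleCyclicOrder (fun x => (b x : UnitAddCircle))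
  image : ∀ g x, (ρ g).1 '' J x = J (g • x)
  fixed : ∀ g x, g • x = x → ∀ ξ ∈ J x, (ρ g).1 ξ = ξ

/-! Blow up each point x to an arc of length `l x`, laid out around the circle in the cyclic order,
where `l > 0` has total mass 1. Let g carry the arc of x to the arc of g•x by a diffeomorphism
tangent to the identity at both ends, chosen functorially in the two lengths. The Yoccoz maps do
this: in the coordinate tan(π(s/l - 1/2))/l they are the identity of ℝ, so composition holds exactly
(`yoccozMap_comp`), and their derivative differs from 1 by at most |(l'/l)² - 1|
(`abs_yoccozBump_le`).

Only the behaviour where arcs accumulate is at stake. If `l (g • x) / l x` tends to 1 along X, the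
prescribed derivative (1 off the arcs) is a uniform limit of continuous functions
(`continuous_intervalDeriv`). Its integral is a C¹ lift whose values on the arcs are found by
summing arc lengths (`integral_intervalDeriv_arcWeight`). Since the arcs are dense, the homomorphism
property extends by continuity (`actionMap_mul`). The inverse of the map of g is the map of g⁻¹,
hence also C¹.

Growth enters only in the choice of `l` (`SubexpOrbitGrowth.exists_weights`). For finite S and E,
the function f(y) = Σ r^k [y ∈ S^k E] is summable for r < 1, and satisfies f(g•y) ≤ r⁻¹ f(y) when
g⁻¹ ∈ S. Take such functions with S and E exhausting G and X and r increasing to 1, and add them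
with small coefficients. Off a finite set each is negligible against the later ones, so the ratios
of the sum are governed by r arbitrarily close to 1. The first r already gives the uniform bound on
a prescribed finite set. -/

/-! ### Asymptotically invariant weights from subexponential growth -/

theorem Set.Finite.monoid_pow {M : Type*} [Monoid M] {s : Set M} (hs : s.Finite) :
    ∀ k : ℕ, (s ^ k).Finite
  | 0 => by rw [pow_zero]; exact Set.finite_one
  | k + 1 => by rw [pow_succ]; exact (hs.monoid_pow k).mul hs

/-- Subexponential growth of orbits makes the orbit-growth series converge inside the unit disc. -/
theorem SubexpOrbitGrowth.tsum_ne_top {G X : Type*} [Group G] [MulAction G X]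
    (hX : SubexpOrbitGrowth G X) {S : Finset G} (hS : S.Nonempty) (x : X) {r : ℝ}
    (hr0 : 0 < r) (hr1 : r < 1) :
    ∑' k : ℕ, ENNReal.ofReal r ^ k *
      (((fun g : G => g • x) '' ((S : Set G) ^ k)).encard : ENNReal) ≠ ⊤ := by
  have hfin : ∀ k : ℕ, ((fun g : G => g • x) '' ((S : Set G) ^ k)).Finite := fun k =>
    (Set.Finite.monoid_pow S.finite_toSet k).image _
  set N : ℕ → ℕ := fun k => ((fun g : G => g • x) '' ((S : Set G) ^ k)).ncard with hN
  have hlim := hX S hS x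
  -- Eventually |S^k x| ≤ R^k because R > 1, and r R < 1 makes the comparison series geometric.
  obtain ⟨R, hR1, hR2⟩ : ∃ R : ℝ, 1 < R ∧ R < r⁻¹ := exists_between ((one_lt_inv₀ hr0).2 hr1)
  have hR0 : 0 < R := one_pos.trans hR1
  have hrR : r * R < 1 := by
    calc r * R < r * r⁻¹ := by gcongr
      _ = 1 := mul_inv_cancel₀ hr0.ne'
  have hev : ∀ᶠ k : ℕ in Filter.atTop, ‖r ^ k * (N k : ℝ)‖ ≤ (r * R) ^ k := by
    filter_upwards [hlim.eventually (gt_mem_nhds hR1), Filter.eventually_gt_atTop 0] with k hk hk0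
    have hNk : (N k : ℝ) ≤ R ^ k := by
      have h1 : (N k : ℝ) = ((N k : ℝ) ^ (1 / (k : ℝ))) ^ k := by
        rw [one_div, Real.rpow_inv_natCast_pow (Nat.cast_nonneg _) hk0.ne']
      rw [h1]
      exact pow_le_pow_left₀ (by positivity) hk.le k
    rw [Real.norm_of_nonneg (by positivity), mul_pow]
    gcongr
  have hs : Summable fun k : ℕ => r ^ k * (N k : ℝ) :=
    Summable.of_norm_bounded_eventually_nat
      (summable_geometric_of_lt_one (by positivity) hrR) hev
  have := hs.tsum_ofReal_ne_top
  convert this using 3 with k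
  rw [ENNReal.ofReal_mul (by positivity), ENNReal.ofReal_pow hr0.le, ENNReal.ofReal_natCast,
    ← (hfin k).cast_ncard_eq]
  rfl

theorem SubexpOrbitGrowth.tsum_tsum_ne_top {G X : Type*} [Group G] [MulAction G X]
    (hX : SubexpOrbitGrowth G X) {S : Finset G} (hS : S.Nonempty) (E : Finset X) {r : ℝ}
    (hr0 : 0 < r) (hr1 : r < 1) :
    ∑' y : X, ∑' k : ℕ, ENNReal.ofReal r ^ k *
      ((S : Set G) ^ k • (E : Set X)).indicator (1 : X → ENNReal) y ≠ ⊤ := by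
  have hle : ∑' y : X, ∑' k : ℕ, ENNReal.ofReal r ^ k *
      ((S : Set G) ^ k • (E : Set X)).indicator (1 : X → ENNReal) y ≤
      ∑ x ∈ E, ∑' k : ℕ, ENNReal.ofReal r ^ k *
      (((fun g : G => g • x) '' ((S : Set G) ^ k)).encard : ENNReal) := by
    rw [ENNReal.tsum_comm, ← Summable.tsum_finsetSum (fun _ _ => ENNReal.summable)]
    refine ENNReal.tsum_le_tsum fun k => ?_
    rw [ENNReal.tsum_mul_left, ← Finset.mul_sum]
    gcongr
    have h1 : ∀ x ∈ E, (((fun g : G => g • x) '' ((S : Set G) ^ k)).encard : ENNReal) =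
        ∑' y, ((fun g : G => g • x) '' ((S : Set G) ^ k)).indicator (1 : X → ENNReal) y := by
      intro x _
      rw [← ENNReal.tsum_set_one, tsum_subtype _ (fun _ => (1 : ENNReal))]
      rfl
    rw [Finset.sum_congr rfl h1, ← Summable.tsum_finsetSum (fun _ _ => ENNReal.summable)]
    refine ENNReal.tsum_le_tsum fun y => ?_
    by_cases hy : y ∈ ((S : Set G) ^ k • (E : Set X))
    · rw [Set.indicator_of_mem hy]
      obtain ⟨h, hh, x, hx, rfl⟩ := hy
      refine le_trans ?_ (Finset.single_le_sum (fun _ _ => zero_le) hx)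
      have hm : h • x ∈ (fun g : G => g • x) '' ((S : Set G) ^ k) := ⟨h, hh, rfl⟩
      simp only [Set.indicator_of_mem hm, le_refl, Pi.one_apply]
    · rw [Set.indicator_of_notMem hy]
      exact zero_le
  refine ne_top_of_le_ne_top ?_ hle
  exact (ENNReal.sum_lt_top.2 fun x _ => (hX.tsum_ne_top hS x hr0 hr1).lt_top).ne

/-- A weighted family of decaying functions: if later functions dominate earlier ones at infinity
and are almost invariant under a map `T`, then so is the weighted sum. -/
theorem finite_setOf_lt_tsum_comp {X : Type*} {f : ℕ → X → ENNReal} {c : ℕ → NNReal}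
    (hc : ∀ n, 0 < c n) (T : X ≃ X)
    (hf : ∀ n m, n < m → ∀ η : ENNReal, η ≠ 0 → {y | η * f m y < f n y}.Finite)
    {m : ℕ} {K η : ENNReal} (hη : η ≠ 0)
    (hT : ∀ n, m ≤ n → ∀ y, f n (T y) ≤ K * f n y) :
    {y | (1 + η) * (K * ∑' n, c n * f n y) < ∑' n, c n * f n (T y)}.Finite := by
  set C : ENNReal := ∑ n ∈ Finset.range m, (c n : ENNReal) with hC
  have hCtop : C ≠ ⊤ := (ENNReal.sum_lt_top.2 fun _ _ => ENNReal.coe_lt_top).ne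
  have hcm : (c m : ENNReal) ≠ 0 := by simpa using (hc m).ne'
  -- Chosen so that C η' ≤ η c_m: off the bad set, the first m terms together are at most η times
  -- the single term of index m. The `+ 1` avoids dividing by C = 0 when m = 0.
  set η' : ENNReal := η * c m / (C + 1) with hη'
  have hη'0 : η' ≠ 0 := by
    rw [hη']
    exact (ENNReal.div_pos (mul_ne_zero hη hcm) (by simp [hCtop])).ne'
  have hCη : C * η' ≤ η * c m := by
    rw [hη']
    calc C * (η * c m / (C + 1)) ≤ (C + 1) * (η * c m / (C + 1)) := by gcongr; exact le_self_add
      _ = η * c m := ENNReal.mul_div_cancel (by simp) (by simp [hCtop])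
  have hbad : (⋃ n ∈ Finset.range m, {y | η' * f m y < f n y}).Finite :=
    Set.Finite.biUnion (Finset.finite_toSet _) fun n hn =>
      hf n m (Finset.mem_range.1 hn) η' hη'0
  refine (hbad.preimage T.injective.injOn).subset fun y hy => ?_
  by_contra hcon
  refine absurd (Set.mem_ofPred_eq ▸ hy) (not_lt.2 ?_)
  have hgood : ∀ n ∈ Finset.range m, f n (T y) ≤ η' * f m (T y) := by
    intro n hn
    by_contra hlt
    exact hcon (Set.mem_biUnion hn (not_le.1 hlt))
  have split : ∀ y, ∑' n, (c n : ENNReal) * f n y =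
      ∑ n ∈ Finset.range m, (c n : ENNReal) * f n y +
        ∑' n, (c (n + m) : ENNReal) * f (n + m) y := fun y =>
    (ENNReal.summable.sum_add_tsum_nat_add' (f := fun n => (c n : ENNReal) * f n y)
      (k := m)).symm
  set Q : X → ENNReal := fun y => ∑' n, (c (n + m) : ENNReal) * f (n + m) y with hQ
  have h1 : ∑ n ∈ Finset.range m, (c n : ENNReal) * f n (T y) ≤ η * Q (T y) := by
    calc ∑ n ∈ Finset.range m, (c n : ENNReal) * f n (T y)
        ≤ ∑ n ∈ Finset.range m, (c n : ENNReal) * (η' * f m (T y)) :=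
          Finset.sum_le_sum fun n hn => by gcongr; exact hgood n hn
      _ = C * η' * f m (T y) := by rw [← Finset.sum_mul, mul_assoc]
      _ ≤ η * c m * f m (T y) := by gcongr
      _ = η * (c (0 + m) * f (0 + m) (T y)) := by rw [zero_add, mul_assoc]
      _ ≤ η * Q (T y) := by gcongr; exact ENNReal.le_tsum 0
  have h2 : Q (T y) ≤ K * Q y := by
    rw [hQ]
    simp only
    rw [← ENNReal.tsum_mul_left]
    refine ENNReal.tsum_le_tsum fun n => ?_
    rw [mul_left_comm]
    gcongr
    exact hT _ (Nat.le_add_left _ _) y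
  calc ∑' n, (c n : ENNReal) * f n (T y) ≤ η * Q (T y) + Q (T y) := by
        rw [split]; gcongr
    _ = (1 + η) * Q (T y) := by ring
    _ ≤ (1 + η) * (K * Q y) := by gcongr
    _ ≤ (1 + η) * (K * ∑' n, (c n : ENNReal) * f n y) := by
        gcongr
        rw [split]
        exact le_add_self

/-- Geometric series along an increasing family of set sequences: a smaller ratio is negligible. -/
theorem finite_setOf_mul_lt_tsum_indicator {X : Type*} {A B : ℕ → Set X}
    (hA : ∀ k, (A k).Finite) (hAB : ∀ k, A k ⊆ B k) {r s : ENNReal} (hrs : r < s) (hs : s ≠ ⊤)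
    {η : ENNReal} (hη : η ≠ 0) :
    {y | η * ∑' k, s ^ k * (B k).indicator (1 : X → ENNReal) y <
      ∑' k, r ^ k * (A k).indicator (1 : X → ENNReal) y}.Finite := by
  have hs0 : s ≠ 0 := (zero_le.trans_lt hrs).ne'
  have hq : r / s < 1 := by
    rw [ENNReal.div_lt_iff (Or.inl hs0) (Or.inl hs), one_mul]; exact hrs
  -- Off the finite union of the `A k` with k < K, only terms with k ≥ K survive, and there r^k ≤ η
  -- s^k.
  obtain ⟨K, hK⟩ : ∃ K : ℕ, (r / s) ^ K < η :=
    ((ENNReal.tendsto_pow_atTop_nhds_zero_of_lt_one hq).eventually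
      (gt_mem_nhds (pos_iff_ne_zero.2 hη))).exists
  refine (Set.Finite.biUnion (Finset.finite_toSet (Finset.range K)) fun k _ => hA k).subset ?_
  intro y hy
  by_contra hcon
  refine absurd (Set.mem_ofPred_eq ▸ hy) (not_lt.2 ?_)
  rw [← ENNReal.tsum_mul_left]
  refine ENNReal.tsum_le_tsum fun k => ?_
  by_cases hyA : y ∈ A k
  · rw [Set.indicator_of_mem hyA, Set.indicator_of_mem (hAB k hyA), Pi.one_apply, mul_one, mul_one]
    have hk : K ≤ k := by
      by_contra hk
      exact hcon (Set.mem_biUnion (Finset.mem_coe.2 (Finset.mem_range.2 (not_le.1 hk))) hyA)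
    calc r ^ k = (r / s) ^ k * s ^ k := by
          rw [← mul_pow, ENNReal.div_mul_cancel hs0 hs]
      _ ≤ (r / s) ^ K * s ^ k := by
          gcongr ?_ * _
          exact pow_le_pow_of_le_one zero_le hq.le hk
      _ ≤ η * s ^ k := by gcongr
  · rw [Set.indicator_of_notMem hyA, mul_zero]
    exact zero_le

/-- If g•y lies in S^k E, then y = g⁻¹(g•y) lies in S^(k+1) E; shifting the index of the geometric
series by one costs the factor r⁻¹. -/
theorem tsum_indicator_smul_le {G X : Type*} [Group G] [MulAction G X] {S : Set G} {E : Set X}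
    {g : G} (hg : g⁻¹ ∈ S) {r : ENNReal} (hr0 : r ≠ 0) (hr : r ≠ ⊤) (y : X) :
    ∑' k : ℕ, r ^ k * (S ^ k • E).indicator (1 : X → ENNReal) (g • y) ≤
      r⁻¹ * ∑' k : ℕ, r ^ k * (S ^ k • E).indicator (1 : X → ENNReal) y := by
  have h1 : ∀ k : ℕ, r ^ k * (S ^ k • E).indicator (1 : X → ENNReal) (g • y) ≤
      r⁻¹ * (r ^ (k + 1) * (S ^ (k + 1) • E).indicator (1 : X → ENNReal) y) := by
    intro k
    rw [← mul_assoc, pow_succ', ← mul_assoc, ENNReal.inv_mul_cancel hr0 hr, one_mul]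
    gcongr
    by_cases hy : g • y ∈ S ^ k • E
    · have : y ∈ S ^ (k + 1) • E := by
        obtain ⟨h, hh, x, hx, hxy⟩ := hy
        refine ⟨g⁻¹ * h, ?_, x, hx, ?_⟩
        · rw [pow_succ']
          exact Set.mul_mem_mul hg hh
        · simp only at hxy ⊢
          rw [mul_smul, hxy, inv_smul_smul]
      rw [Set.indicator_of_mem hy, Set.indicator_of_mem this]
      rfl
    · rw [Set.indicator_of_notMem hy]
      exact zero_le
  calc _ ≤ ∑' k : ℕ, r⁻¹ * (r ^ (k + 1) * (S ^ (k + 1) • E).indicator (1 : X → ENNReal) y) :=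
        ENNReal.tsum_le_tsum h1
    _ = r⁻¹ * ∑' k : ℕ, r ^ (k + 1) * (S ^ (k + 1) • E).indicator (1 : X → ENNReal) y :=
        ENNReal.tsum_mul_left
    _ ≤ _ := by
        refine mul_le_mul_right ?_ _
        exact ENNReal.tsum_comp_le_tsum_of_injective (add_left_injective 1)
          (fun k : ℕ => r ^ k * (S ^ k • E).indicator (1 : X → ENNReal) y)

/-- On a countable set with subexponential growth of orbits there are positive weights of total
mass one that are asymptotically invariant, and uniformly close to invariant under finitely many
prescribed elements. -/
theorem SubexpOrbitGrowth.exists_weights {G X : Type*} [Group G] [Countable G] [MulAction G X]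
    [Countable X] [Nonempty X] (hX : SubexpOrbitGrowth G X) (S : Finset G) {δ : ℝ} (hδ : 0 < δ) :
    ∃ l : X → ℝ, (∀ x, 0 < l x) ∧ HasSum l 1 ∧
      (∀ g : G, ∀ η : ℝ, 0 < η → {x | (1 + η) * l x < l (g • x)}.Finite) ∧
      ∀ g ∈ S, ∀ x, l (g • x) ≤ (1 + δ) * l x := by
  classical
  obtain ⟨e, he⟩ := exists_surjective_nat G
  obtain ⟨e', he'⟩ := exists_surjective_nat X
  -- The prescribed elements enter through their inverses, since bounding f(g•y) requires g⁻¹ in the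
  -- set; they are present from n = 0 on.
  set Sn : ℕ → Finset G := fun n => S.image (fun g => g⁻¹) ∪ (Finset.range (n + 1)).image e
    with hSn
  set En : ℕ → Finset X := fun n => (Finset.range (n + 1)).image e' with hEn
  have hSne : ∀ n, (Sn n).Nonempty := fun n =>
    ⟨e 0, by simp only [hSn, Finset.mem_union, Finset.mem_image, Finset.mem_range]
             exact Or.inr ⟨0, by omega, rfl⟩⟩
  have hSmono : ∀ n m, n ≤ m → (Sn n : Set G) ⊆ Sn m := by
    intro n m h
    simp only [hSn, Finset.coe_subset]
    gcongr
  have hEmono : ∀ n m, n ≤ m → (En n : Set X) ⊆ En m := by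
    intro n m h
    simp only [hEn, Finset.coe_subset]
    gcongr
  -- The distortion (q n)⁻¹ = 1 + δ/(n+1) decreases to 1 and equals 1 + δ at n = 0.
  set q : ℕ → ℝ := fun n => (1 + δ / (n + 1))⁻¹ with hq
  have hq0 : ∀ n, 0 < q n := fun n => by positivity
  have hq1 : ∀ n, q n < 1 := fun n => inv_lt_one_of_one_lt₀ (by
    have : 0 < δ / ((n : ℝ) + 1) := by positivity
    linarith)
  have hqlt : ∀ n m, n < m → q n < q m := by
    intro n m h
    simp only [hq]
    gcongr
  have hqinv : ∀ n, (ENNReal.ofReal (q n))⁻¹ = ENNReal.ofReal (1 + δ / (n + 1)) := by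
    intro n
    rw [← ENNReal.ofReal_inv_of_pos (hq0 n), hq]
    simp
  set A : ℕ → ℕ → Set X := fun n k => (Sn n : Set G) ^ k • (En n : Set X) with hA
  set f : ℕ → X → ENNReal := fun n y =>
    ∑' k : ℕ, ENNReal.ofReal (q n) ^ k * (A n k).indicator (1 : X → ENNReal) y with hf
  have hftop : ∀ n, ∑' y, f n y ≠ ⊤ := fun n =>
    hX.tsum_tsum_ne_top (hSne n) (En n) (hq0 n) (hq1 n)
  have hAfin : ∀ n k, (A n k).Finite := fun n k =>
    (Set.Finite.monoid_pow (Sn n).finite_toSet k).smul (En n).finite_toSet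
  have hfη : ∀ n m, n < m → ∀ η : ENNReal, η ≠ 0 → {y | η * f m y < f n y}.Finite := by
    intro n m h η hη
    refine finite_setOf_mul_lt_tsum_indicator (hAfin n) (fun k => ?_)
      ((ENNReal.ofReal_lt_ofReal_iff (hq0 m)).2 (hqlt n m h)) ENNReal.ofReal_ne_top hη
    exact Set.smul_subset_smul (Set.pow_subset_pow_left (hSmono n m h.le)) (hEmono n m h.le)
  have hfT : ∀ n, ∀ g : G, g⁻¹ ∈ Sn n → ∀ y, f n (g • y) ≤
      ENNReal.ofReal (1 + δ / (n + 1)) * f n y := by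
    intro n g hg y
    rw [← hqinv]
    exact tsum_indicator_smul_le (Finset.mem_coe.2 hg)
      (ENNReal.ofReal_pos.2 (hq0 n)).ne' ENNReal.ofReal_ne_top y
  have hmono : ∀ n m : ℕ, m ≤ n → ENNReal.ofReal (1 + δ / (n + 1)) ≤
      ENNReal.ofReal (1 + δ / (m + 1)) := by
    intro n m h
    gcongr
  -- Coefficients small enough, against the masses of the `f n`, for the combined weight to have
  -- finite mass.
  obtain ⟨c, hc0, hcs⟩ := ENNReal.exists_pos_tsum_mul_lt_of_countable one_ne_zero _ hftop
  set w : X → ENNReal := fun y => ∑' n, (c n : ENNReal) * f n y with hw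
  have hwtop : ∑' y, w y ≠ ⊤ := by
    rw [hw, ENNReal.tsum_comm]
    simp_rw [ENNReal.tsum_mul_left]
    simp_rw [mul_comm (c _ : ENNReal)]
    exact (hcs.trans ENNReal.one_lt_top).ne
  have hwtop' : ∀ y, w y ≠ ⊤ := fun y => ENNReal.ne_top_of_tsum_ne_top hwtop y
  have hwpos : ∀ y, 0 < w y := by
    intro y
    obtain ⟨n, rfl⟩ := he' y
    have h1 : f n (e' n) ≠ 0 := by
      have hmem : e' n ∈ A n 0 := by
        refine ⟨1, by simp, e' n, ?_, one_smul _ _⟩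
        simp only [hEn, Finset.coe_image, Set.mem_image, Finset.mem_coe, Finset.mem_range]
        exact ⟨n, by omega, rfl⟩
      have : (1 : ENNReal) ≤ f n (e' n) := by
        refine le_trans ?_ (ENNReal.le_tsum 0)
        rw [Set.indicator_of_mem hmem]
        simp
      exact (zero_lt_one.trans_le this).ne'
    refine lt_of_lt_of_le ?_ (ENNReal.le_tsum n)
    exact pos_iff_ne_zero.2 (mul_ne_zero (by simpa using (hc0 n).ne') h1)
  have hwg : ∀ g : G, ∀ η : ℝ, 0 < η → {x | ENNReal.ofReal (1 + η) * w x < w (g • x)}.Finite := by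
    intro g η hη
    obtain ⟨n, hn⟩ := he g⁻¹
    -- One factor 1 + θ absorbs the negligible head of the series, the other the distortion of its
    -- tail.
    obtain ⟨θ, hθ0, hθ⟩ : ∃ θ : ℝ, 0 < θ ∧ (1 + θ) * (1 + θ) ≤ 1 + η := by
      refine ⟨min 1 (η / 3), by positivity, ?_⟩
      have h1 := min_le_left 1 (η / 3)
      have h2 := min_le_right 1 (η / 3)
      have h3 : 0 < min 1 (η / 3) := by positivity
      nlinarith
    obtain ⟨N, hN⟩ : ∃ N : ℕ, δ / ((N : ℝ) + 1) < θ := by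
      obtain ⟨N, hN⟩ := exists_nat_gt (δ / θ)
      refine ⟨N, ?_⟩
      rw [div_lt_iff₀ hθ0] at hN
      rw [div_lt_iff₀ (by positivity)]
      linarith
    -- From index n on, g⁻¹ belongs to `Sn`; from index N on, the distortion is at most 1 + θ.
    have key := finite_setOf_lt_tsum_comp (f := f) hc0 (MulAction.toPerm g) hfη (m := max n N)
      (K := ENNReal.ofReal (1 + θ)) (η := ENNReal.ofReal θ) (ENNReal.ofReal_pos.2 hθ0).ne'
      (by
        intro k hk y
        refine (hfT k g ?_ y).trans ?_
        · simp only [hSn, Finset.mem_union, Finset.mem_image, Finset.mem_range]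
          exact Or.inr ⟨n, by have := (le_max_left n N).trans hk; omega, hn⟩
        · gcongr
          refine le_trans ?_ hN.le
          have : (N : ℝ) ≤ k := by exact_mod_cast (le_max_right n N).trans hk
          gcongr)
    refine key.subset fun y hy => Set.mem_ofPred_eq ▸ lt_of_le_of_lt ?_ (Set.mem_ofPred_eq ▸ hy)
    rw [← mul_assoc]
    gcongr
    rw [← ENNReal.ofReal_one, ← ENNReal.ofReal_add zero_le_one hθ0.le,
      ← ENNReal.ofReal_mul (by positivity)]
    exact ENNReal.ofReal_le_ofReal hθ
  have hwS : ∀ g ∈ S, ∀ x, w (g • x) ≤ ENNReal.ofReal (1 + δ) * w x := by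
    intro g hg x
    rw [hw]
    simp only
    rw [← ENNReal.tsum_mul_left]
    refine ENNReal.tsum_le_tsum fun n => ?_
    rw [mul_left_comm]
    gcongr
    refine (hfT n g ?_ x).trans ?_
    · simp only [hSn, Finset.mem_union, Finset.mem_image]
      exact Or.inl ⟨g, hg, rfl⟩
    · have := hmono n 0 (Nat.zero_le n)
      simp only [Nat.cast_zero, zero_add, div_one] at this
      gcongr
  have hsum : Summable fun x => (w x).toReal := ENNReal.summable_toReal hwtop
  set M : ℝ := ∑' x, (w x).toReal with hM
  have hpos : ∀ x, 0 < (w x).toReal := fun x => ENNReal.toReal_pos (hwpos x).ne' (hwtop' x)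
  have hM0 : 0 < M := hsum.tsum_pos (fun x => (hpos x).le) (Classical.arbitrary X) (hpos _)
  have conv : ∀ (t : ℝ), 0 < t → ∀ x y, w y ≤ ENNReal.ofReal t * w x ↔
      (w y).toReal / M ≤ t * ((w x).toReal / M) := by
    intro t ht x y
    rw [← mul_div_assoc, div_le_div_iff_of_pos_right hM0,
      ← ENNReal.toReal_le_toReal (hwtop' y) (ENNReal.mul_ne_top ENNReal.ofReal_ne_top (hwtop' x)),
      ENNReal.toReal_mul, ENNReal.toReal_ofReal ht.le]
  refine ⟨fun x => (w x).toReal / M, fun x => div_pos (hpos x) hM0, ?_, ?_, ?_⟩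
  · have := hsum.hasSum.div_const M
    rwa [← hM, div_self hM0.ne'] at this
  · intro g η hη
    refine (hwg g η hη).subset fun x hx => ?_
    by_contra hcon
    exact absurd ((conv (1 + η) (by positivity) x (g • x)).1 (not_lt.1 hcon)) (not_le.2 hx)
  · intro g hg x
    exact (conv (1 + δ) (by positivity) x (g • x)).1 (hwS g hg x)

/-! ### Cutting a cyclic order into a linear order; weights of arcs -/

theorem SignType.coe_int_inj {s t : SignType} (h : (s : ℤ) = t) : s = t := by
  revert s t; decide

namespace CyclicOrder

variable {X : Type*}

/-- Antisymmetry is not an axiom: it comes from the cocycle identity on a quadruple with a repeated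
point. -/
theorem swap_right (c : CyclicOrder X) (x y z : X) : (c.c x z y : ℤ) = -c.c x y z := by
  have h := c.cocycle x y z y
  rw [(c.eq_zero_iff y z y).2 (Or.inr (Or.inr rfl)), (c.eq_zero_iff x y y).2 (Or.inr (Or.inl rfl))]
    at h
  simp at h
  linarith

theorem swap_left (c : CyclicOrder X) (x y z : X) : (c.c y x z : ℤ) = -c.c x y z := by
  have h := c.cocycle x y x z
  rw [(c.eq_zero_iff x x z).2 (Or.inl rfl), (c.eq_zero_iff x y x).2 (Or.inr (Or.inr rfl))]
    at h
  simp at h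
  linarith

open Classical in
/-- The linear order obtained by cutting a cyclic order just before `p`, in the form of a
comparison function: `c.cut p x y = 1` means that `x` comes before `y`. -/
noncomputable def cut (c : CyclicOrder X) (p x y : X) : SignType :=
  if x = y then 0 else if x = p then 1 else if y = p then -1 else c.c p x y

theorem cut_self (c : CyclicOrder X) (p x : X) : c.cut p x x = 0 := by simp [cut]

theorem cut_base (c : CyclicOrder X) {p y : X} (h : p ≠ y) : c.cut p p y = 1 := by simp [cut, h]

theorem cut_swap (c : CyclicOrder X) (p x y : X) : (c.cut p y x : ℤ) = -c.cut p x y := by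
  by_cases hxy : x = y
  · subst hxy
    simp [cut_self]
  by_cases hx : x = p
  · subst hx
    simp [cut, hxy, Ne.symm hxy]
  by_cases hy : y = p
  · subst hy
    simp [cut, hxy, Ne.symm hxy]
  simp only [cut, hxy, Ne.symm hxy, hx, hy, if_false]
  exact c.swap_right p x y

theorem cut_ne_zero (c : CyclicOrder X) (p : X) {x y : X} (h : x ≠ y) : c.cut p x y ≠ 0 := by
  by_cases hx : x = p
  · subst hx
    simp [cut, h]
  by_cases hy : y = p
  · subst hy
    simp [cut, hx]
  simp only [cut, h, hx, hy, if_false, ne_eq, c.eq_zero_iff, or_false, Ne.symm hx, Ne.symm hy,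
    not_false_eq_true]

/-- For distinct points other than p this is the cocycle identity with p as first point. It exhibits
`c` as the coboundary of the sign function of a linear order, so later comparisons reduce to linear
ones. -/
theorem c_eq_cut (c : CyclicOrder X) (p x y z : X) :
    (c.c x y z : ℤ) = c.cut p y z - c.cut p x z + c.cut p x y := by
  by_cases hxy : x = y
  · subst hxy
    simp [(c.eq_zero_iff x x z).2 (Or.inl rfl), cut_self]
  by_cases hyz : y = z
  · subst hyz
    simp [(c.eq_zero_iff x y y).2 (Or.inr (Or.inl rfl)), cut_self]
  by_cases hxz : x = z
  · subst hxz
    have := c.cut_swap p x y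
    simp [(c.eq_zero_iff x y x).2 (Or.inr (Or.inr rfl)), cut_self, this]
  have h1 := c.swap_left x y z
  have h2 := c.swap_right x y z
  have h3 := c.cocycle p x y z
  unfold cut
  by_cases hx : x = p
  · subst hx
    simp [hxy, hyz, hxz, Ne.symm hxy, Ne.symm hxz]
  by_cases hy : y = p
  · subst hy
    simp only [hx, hyz, hxz, Ne.symm hyz, if_true, if_false]
    push_cast
    omega
  by_cases hz : z = p
  · subst hz
    have h4 := c.swap_left x z y
    simp only [hxy, hyz, hxz, if_true, if_false]
    push_cast
    omega
  simp only [hxy, hyz, hxz, hx, hy, hz, if_false]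
  omega

/-- The coboundary formula reads c(x,y,z) = 2 - cut(x,z), and a sign is at most 1. -/
theorem cut_trans (c : CyclicOrder X) {p x y z : X} (hxy : c.cut p x y = 1)
    (hyz : c.cut p y z = 1) : c.cut p x z = 1 := by
  have h := c.c_eq_cut p x y z
  rw [hxy, hyz] at h
  revert h
  generalize c.c x y z = s
  generalize c.cut p x z = t
  revert s t
  decide

theorem cut_smul {G : Type*} [Group G] [MulAction G X] (c : CyclicOrder X)
    (hc : ∀ g : G, c.Preserves c (fun x => g • x)) (g : G) (p x y : X) :
    c.cut (g • p) (g • x) (g • y) = c.cut p x y := by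
  have h := hc g p x y
  by_cases hxy : x = y
  · simp [hxy, cut_self]
  by_cases hx : x = p
  · subst hx
    rw [c.cut_base hxy, c.cut_base (by simpa using hxy)]
  by_cases hy : y = p <;> simp [cut, hxy, hx, hy, h]

-- Moving the cut from p to q: the indicator of [q, x) is that of [p, x) minus that of [p, q), plus
-- 1 if x comes before q and the arc wraps past p.
open Classical in
theorem ite_cut_change (c : CyclicOrder X) (p q x y : X) :
    (if c.cut q y x = 1 then (1 : ℤ) else 0) = (if c.cut p y x = 1 then 1 else 0) -
      (if c.cut p y q = 1 then 1 else 0) + (if c.cut p x q = 1 then 1 else 0) := by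
  by_cases hyx : y = x
  · subst hyx; simp [cut_self]
  by_cases hxq : x = q
  · subst hxq
    have h1 : c.cut x y x ≠ 1 := by simp [cut, hyx]
    simp [h1, cut_self]
  by_cases hyq : y = q
  · subst hyq
    have h1 := c.cut_swap p x y
    have h2 := c.cut_ne_zero p hxq
    simp only [c.cut_base hyx, cut_self, if_true]
    revert h1 h2
    generalize c.cut p x y = s
    generalize c.cut p y x = t
    revert s t
    decide
  have h0 : c.cut q y x = c.c q y x := by simp [cut, hyx, hxq, hyq]
  have h1 := c.c_eq_cut p q y x
  have h2 := c.cut_swap p q x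
  have h3 := c.cut_swap p q y
  have h4 := c.cut_ne_zero p hyx
  have h5 := c.cut_ne_zero p (Ne.symm hxq)
  have h6 := c.cut_ne_zero p (Ne.symm hyq)
  rw [h0]
  revert h1 h2 h3 h4 h5 h6
  generalize c.c q y x = s0
  generalize c.cut p y x = s1
  generalize c.cut p q x = s2
  generalize c.cut p q y = s3
  generalize c.cut p x q = s4
  generalize c.cut p y q = s5
  revert s0 s1 s2 s3 s4 s5
  decide

open Classical in
/-- The total weight of the half-open arc `[p, x)`. -/
noncomputable def arcWeight (c : CyclicOrder X) (l : X → ℝ) (p x : X) : ℝ :=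
  ∑' y, if c.cut p y x = 1 then l y else 0

variable {l : X → ℝ}

open Classical in
theorem hasSum_arcWeight (c : CyclicOrder X) (hl0 : ∀ x, 0 < l x) (hl : Summable l) (p x : X) :
    HasSum (fun y => if c.cut p y x = 1 then l y else 0) (c.arcWeight l p x) := by
  refine (Summable.of_nonneg_of_le (fun y => ?_) (fun y => ?_) hl).hasSum
  · split_ifs
    exacts [(hl0 y).le, le_rfl]
  · split_ifs
    exacts [le_rfl, (hl0 y).le]

theorem arcWeight_nonneg (c : CyclicOrder X) (hl0 : ∀ x, 0 < l x) (p x : X) :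
    0 ≤ c.arcWeight l p x := by
  classical
  refine tsum_nonneg fun y => ?_
  split_ifs
  exacts [(hl0 y).le, le_rfl]

open Classical in
theorem hasSum_arcWeight_add (c : CyclicOrder X) (hl0 : ∀ x, 0 < l x) (hl : Summable l) (p x : X) :
    HasSum (fun y => (if c.cut p y x = 1 then l y else 0) + if y = x then l x else 0)
      (c.arcWeight l p x + l x) :=
  (c.hasSum_arcWeight hl0 hl p x).add (hasSum_ite_eq x (l x))

theorem arcWeight_add_le (c : CyclicOrder X) (hl0 : ∀ x, 0 < l x) (hl : Summable l) {p x y : X}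
    (h : c.cut p x y = 1) : c.arcWeight l p x + l x ≤ c.arcWeight l p y := by
  classical
  refine hasSum_le (fun z => ?_) (c.hasSum_arcWeight_add hl0 hl p x) (c.hasSum_arcWeight hl0 hl p y)
  by_cases hz : z = x
  · subst hz
    simp [cut_self, h]
  · by_cases hzx : c.cut p z x = 1
    · simp [hz, hzx, c.cut_trans hzx h]
    · simp only [hzx, hz, if_false, add_zero]
      split_ifs
      exacts [(hl0 z).le, le_rfl]

theorem arcWeight_add_le_one (c : CyclicOrder X) (hl0 : ∀ x, 0 < l x) (hl : HasSum l 1) (p x : X) :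
    c.arcWeight l p x + l x ≤ 1 := by
  classical
  refine hasSum_le (fun z => ?_) (c.hasSum_arcWeight_add hl0 hl.summable p x) hl
  by_cases hz : z = x
  · subst hz
    simp [cut_self]
  · simp only [hz, if_false, add_zero]
    split_ifs
    exacts [le_rfl, (hl0 z).le]

/-- Sum the change-of-cut identity against `l`. The total mass is 1, so wrapping contributes an
integer, which disappears in ℝ/ℤ. -/
theorem exists_arcWeight_eq (c : CyclicOrder X) (hl0 : ∀ x, 0 < l x) (hl : HasSum l 1)
    (p q x : X) : ∃ n : ℤ, c.arcWeight l q x = c.arcWeight l p x - c.arcWeight l p q + n := by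
  classical
  refine ⟨if c.cut p x q = 1 then 1 else 0, ?_⟩
  have h1 := ((c.hasSum_arcWeight hl0 hl.summable p x).sub
    (c.hasSum_arcWeight hl0 hl.summable p q)).add
    (hl.mul_left (((if c.cut p x q = 1 then 1 else 0 : ℤ) : ℝ)))
  rw [mul_one] at h1
  refine (c.hasSum_arcWeight hl0 hl.summable q x).unique (HasSum.congr_fun h1 fun y => ?_)
  have h2 := congrArg (fun n : ℤ => (n : ℝ) * l y) (c.ite_cut_change p q x y)
  push_cast at h2
  rw [add_mul, sub_mul] at h2
  simp only [ite_mul, one_mul, zero_mul] at h2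
  push_cast
  simp only [ite_mul, one_mul, zero_mul]
  exact h2

end CyclicOrder

/-! ### The cyclic order of the circle in real coordinates -/

theorem UnitAddCircle.btw_coe_iff {t₁ t₂ t₃ : ℝ} (h₁₂ : |t₁ - t₂| < 1) (h₁₃ : |t₁ - t₃| < 1) :
    btw (t₁ : UnitAddCircle) t₂ t₃ ↔
      (if t₁ ≤ t₂ then t₂ else t₂ + 1) ≤ (if t₁ < t₃ then t₃ else t₃ + 1) := by
  rw [abs_lt] at h₁₂ h₁₃
  have h1 : toIcoMod (one_pos : (0 : ℝ) < 1) t₁ t₂ = if t₁ ≤ t₂ then t₂ else t₂ + 1 := by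
    split_ifs with h
    · rw [toIcoMod_eq_self]
      constructor <;> linarith
    · rw [← toIcoMod_add_right, toIcoMod_eq_self]
      constructor <;> linarith
  have h2 : toIocMod (one_pos : (0 : ℝ) < 1) t₁ t₃ = if t₁ < t₃ then t₃ else t₃ + 1 := by
    split_ifs with h
    · rw [toIocMod_eq_self]
      constructor <;> linarith
    · rw [← toIocMod_add_right, toIocMod_eq_self]
      constructor <;> linarith
  rw [← h1, ← h2]
  exact QuotientAddGroup.btw_coe_iff

-- The same coboundary formula as `CyclicOrder.c_eq_cut`, valid for representatives at mutual
-- distance less than 1.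
open Classical in
theorem circleCyclicOrder_coe {t₁ t₂ t₃ : ℝ} (h₁₂ : |t₁ - t₂| < 1) (h₁₃ : |t₁ - t₃| < 1)
    (h₂₃ : |t₂ - t₃| < 1) :
    (circleCyclicOrder.c (t₁ : UnitAddCircle) t₂ t₃ : ℤ) =
      SignType.sign (t₃ - t₂) - SignType.sign (t₃ - t₁) + SignType.sign (t₂ - t₁) := by
  have hp : sbtw (t₁ : UnitAddCircle) t₂ t₃ ↔ ¬ btw (t₃ : UnitAddCircle) t₂ t₁ := sbtw_iff_not_btw
  have hn : sbtw (t₃ : UnitAddCircle) t₂ t₁ ↔ ¬ btw (t₁ : UnitAddCircle) t₂ t₃ := sbtw_iff_not_btw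
  rw [UnitAddCircle.btw_coe_iff (by rwa [abs_sub_comm]) (by rwa [abs_sub_comm])] at hp
  rw [UnitAddCircle.btw_coe_iff h₁₂ h₁₃] at hn
  have hcc : circleCyclicOrder.c (t₁ : UnitAddCircle) t₂ t₃ =
      if sbtw (t₁ : UnitAddCircle) t₂ t₃ then 1
      else if sbtw (t₃ : UnitAddCircle) t₂ t₁ then -1 else 0 := rfl
  rw [hcc]
  simp only [hp, hn, sign_apply, sub_pos, sub_neg]
  rw [abs_lt] at h₁₂ h₁₃ h₂₃
  rcases lt_trichotomy t₁ t₂ with h1 | h1 | h1 <;> rcases lt_trichotomy t₁ t₃ with h2 | h2 | h2 <;>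
    rcases lt_trichotomy t₂ t₃ with h3 | h3 | h3 <;> first | (exfalso; linarith) | skip
  all_goals
    first | subst h1 | skip
    first | subst h2 | skip
    first | subst h3 | skip
    simp only [*, lt_irrefl, le_refl, not_lt_of_gt, not_le_of_gt, le_of_lt, if_true, if_false]
    clear hp hn hcc
    split_ifs <;> first | rfl | (exfalso; grind)

/-- Both cyclic orders are coboundaries of signs of linear orders, so it suffices to be increasing
for the order cut at p. -/
theorem CyclicOrder.preserves_circle_of_monotone {X : Type*} (c : CyclicOrder X) (p : X)
    {h : X → ℝ} (h1 : ∀ x y, |h x - h y| < 1) (hlt : ∀ x y, c.cut p x y = 1 → h x < h y) :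
    c.Preserves circleCyclicOrder (fun x => (h x : UnitAddCircle)) := by
  have hs : ∀ x y, SignType.sign (h y - h x) = c.cut p x y := by
    intro x y
    have hsw := c.cut_swap p x y
    rcases hxy : c.cut p x y with _ | _ | _
    · have : x = y := by
        by_contra hne
        exact c.cut_ne_zero p hne hxy
      subst this
      simp
    · rw [hxy] at hsw
      have : c.cut p y x = 1 := SignType.coe_int_inj (by rw [hsw]; rfl)
      exact sign_neg (sub_neg.2 (hlt _ _ this))
    · exact sign_pos (sub_pos.2 (hlt _ _ hxy))
  intro x y z
  apply SignType.coe_int_inj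
  rw [circleCyclicOrder_coe (h1 _ _) (h1 _ _) (h1 _ _), hs, hs, hs, c.c_eq_cut p]

/-! ### Yoccoz interval diffeomorphisms -/

/-- The Yoccoz diffeomorphism `(0, l) → (0, l')`, conjugate to the identity of `ℝ` through suitably
normalised tangents; it is tangent to the identity at both ends. -/
noncomputable def yoccozMap (l l' s : ℝ) : ℝ :=
  l' * (1 / 2 + Real.arctan (l' / l * Real.tan (Real.pi * (s / l - 1 / 2))) / Real.pi)

/-- The derivative of `yoccozMap l l'` minus one, extended by zero outside `[0, l]`. -/
noncomputable def yoccozBump (l l' s : ℝ) : ℝ :=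
  1 / (1 + ((l / l') ^ 2 - 1) * Real.sin (Real.pi * max 0 (min 1 (s / l))) ^ 2) - 1

section Yoccoz

variable {l l' : ℝ}

theorem yoccozMap_mem_Ioo (hl' : 0 < l') (s : ℝ) : yoccozMap l l' s ∈ Set.Ioo 0 l' := by
  have hpi := Real.pi_pos
  set A := Real.arctan (l' / l * Real.tan (Real.pi * (s / l - 1 / 2)))
  have h1 : -(1 / 2) < A / Real.pi := by
    rw [lt_div_iff₀ hpi]
    have := Real.neg_pi_div_two_lt_arctan (l' / l * Real.tan (Real.pi * (s / l - 1 / 2)))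
    linarith
  have h2 : A / Real.pi < 1 / 2 := by
    rw [div_lt_iff₀ hpi]
    have := Real.arctan_lt_pi_div_two (l' / l * Real.tan (Real.pi * (s / l - 1 / 2)))
    linarith
  constructor
  · exact mul_pos hl' (by linarith)
  · calc yoccozMap l l' s = l' * (1 / 2 + A / Real.pi) := rfl
      _ < l' * 1 := by gcongr; linarith
      _ = l' := mul_one _

/-- The map multiplies tan(π(s/l - 1/2)) by l'/l, and these factors multiply. This is what makes the
action a homomorphism on the arcs. -/
theorem yoccozMap_comp (hl : 0 < l) (hl' : 0 < l') (l'' s : ℝ) :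
    yoccozMap l' l'' (yoccozMap l l' s) = yoccozMap l l'' s := by
  have hpi := Real.pi_ne_zero
  have h : Real.pi * (yoccozMap l l' s / l' - 1 / 2) =
      Real.arctan (l' / l * Real.tan (Real.pi * (s / l - 1 / 2))) := by
    unfold yoccozMap
    field_simp
    ring
  have h2 : l'' / l' * (l' / l) = l'' / l := by field_simp
  rw [yoccozMap, h, Real.tan_arctan, yoccozMap, ← mul_assoc, h2]

theorem angle_mem_Ioo {s : ℝ} (hs : s ∈ Set.Ioo 0 l) :
    Real.pi * (s / l - 1 / 2) ∈ Set.Ioo (-(Real.pi / 2)) (Real.pi / 2) := by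
  have hl : 0 < l := hs.1.trans hs.2
  have h1 : 0 < s / l := div_pos hs.1 hl
  have h2 : s / l < 1 := (div_lt_one hl).2 hs.2
  constructor <;> nlinarith [Real.pi_pos]

theorem yoccozMap_self {s : ℝ} (hs : s ∈ Set.Ioo 0 l) : yoccozMap l l s = s := by
  have hl : 0 < l := hs.1.trans hs.2
  have h := angle_mem_Ioo hs
  rw [yoccozMap, div_self hl.ne', one_mul, Real.arctan_tan h.1 h.2]
  field_simp
  ring

theorem yoccozBump_denom_pos (hl : 0 < l) (hl' : 0 < l') (θ : ℝ) :
    0 < 1 + ((l / l') ^ 2 - 1) * Real.sin θ ^ 2 := by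
  have h1 : 0 < (l / l') ^ 2 := by positivity
  have h2 := Real.sin_sq_add_cos_sq θ
  have h3 := sq_nonneg (Real.sin θ)
  have h4 := sq_nonneg (Real.cos θ)
  have h5 : 1 + ((l / l') ^ 2 - 1) * Real.sin θ ^ 2 =
      Real.cos θ ^ 2 + (l / l') ^ 2 * Real.sin θ ^ 2 := by linarith
  rw [h5]
  rcases h3.eq_or_lt with h | h
  · rw [← h] at h2 ⊢
    linarith
  · positivity

theorem continuous_yoccozBump (hl : 0 < l) (hl' : 0 < l') : Continuous (yoccozBump l l') := by
  unfold yoccozBump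
  refine Continuous.sub (continuous_const.div ?_ fun s => (yoccozBump_denom_pos hl hl' _).ne')
    continuous_const
  fun_prop

theorem neg_one_lt_yoccozBump (hl : 0 < l) (hl' : 0 < l') (s : ℝ) : -1 < yoccozBump l l' s := by
  have := one_div_pos.2 (yoccozBump_denom_pos hl hl' (Real.pi * max 0 (min 1 (s / l))))
  unfold yoccozBump
  linarith

theorem yoccozBump_of_nonpos (hl : 0 < l) {s : ℝ} (hs : s ≤ 0) : yoccozBump l l' s = 0 := by
  have : s / l ≤ 0 := div_nonpos_of_nonpos_of_nonneg hs hl.le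
  simp [yoccozBump, max_eq_left ((min_le_right 1 (s / l)).trans this)]

theorem yoccozBump_of_ge (hl : 0 < l) {s : ℝ} (hs : l ≤ s) : yoccozBump l l' s = 0 := by
  have : 1 ≤ s / l := (one_le_div hl).2 hs
  simp [yoccozBump, min_eq_left this]

theorem abs_yoccozBump_le (hl : 0 < l) (hl' : 0 < l') (s : ℝ) :
    |yoccozBump l l' s| ≤ |(l' / l) ^ 2 - 1| := by
  unfold yoccozBump
  set θ := Real.pi * max 0 (min 1 (s / l))
  have hd := yoccozBump_denom_pos hl hl' θ
  set q := Real.sin θ ^ 2 with hq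
  have hq0 : 0 ≤ q := sq_nonneg _
  have hq1 : q ≤ 1 := Real.sin_sq_le_one θ
  set k := (l / l') ^ 2 with hk
  have hk0 : 0 < k := by positivity
  have hkinv : (l' / l) ^ 2 = 1 / k := by
    rw [hk]; field_simp
  rw [hkinv]
  have e1 : 1 / (1 + (k - 1) * q) - 1 = (1 - k) * (q / (1 + (k - 1) * q)) := by
    field_simp
    ring
  have e2 : 1 / k - 1 = (1 - k) * (1 / k) := by
    field_simp
  rw [e1, e2, abs_mul, abs_mul]
  refine mul_le_mul_of_nonneg_left ?_ (abs_nonneg _)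
  rw [abs_of_nonneg (by positivity), abs_of_nonneg (by positivity),
    -- What remains is k q ≤ 1 + (k - 1) q, that is q ≤ 1; the deviation is extreme at the midpoint
    -- of the interval.
    div_le_div_iff₀ hd hk0]
  nlinarith

theorem hasDerivAt_yoccozMap (hl' : 0 < l') {s : ℝ} (hs : s ∈ Set.Ioo 0 l) :
    HasDerivAt (yoccozMap l l') (1 + yoccozBump l l' s) s := by
  have hl : 0 < l := hs.1.trans hs.2
  have hpi := Real.pi_pos
  have hθ := angle_mem_Ioo hs
  have hcos : 0 < Real.cos (Real.pi * (s / l - 1 / 2)) := Real.cos_pos_of_mem_Ioo hθ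
  have h1 : HasDerivAt (fun s : ℝ => Real.pi * (s / l - 1 / 2)) (Real.pi * (1 / l)) s :=
    (((hasDerivAt_id s).div_const l).sub_const _).const_mul _
  have h2 := (((((Real.hasDerivAt_tan hcos.ne').comp s h1).const_mul (l' / l)).arctan).div_const
    Real.pi).const_add (1 / 2) |>.const_mul l'
  refine h2.congr_deriv ?_
  have hsin : Real.sin (Real.pi * max 0 (min 1 (s / l))) =
      Real.cos (Real.pi * (s / l - 1 / 2)) := by
    rw [min_eq_right ((div_le_one hl).2 hs.2.le), max_eq_right (div_nonneg hs.1.le hl.le)]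
    rw [← Real.cos_sub_pi_div_two]
    congr 1
    ring
  rw [yoccozBump, hsin]
  have hden := yoccozBump_denom_pos hl hl' (Real.pi * max 0 (min 1 (s / l)))
  rw [hsin] at hden
  simp only [Function.comp, Real.tan_eq_sin_div_cos]
  have hsq := Real.sin_sq_add_cos_sq (Real.pi * (s / l - 1 / 2))
  set C := Real.cos (Real.pi * (s / l - 1 / 2))
  set Z := Real.sin (Real.pi * (s / l - 1 / 2))
  have hZ : Z ^ 2 = 1 - C ^ 2 := by linarith
  have hpos : 0 < 1 + (l' / l * (Z / C)) ^ 2 := by positivity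
  have e1 : 1 + (l' / l * (Z / C)) ^ 2 =
      (l' / l) ^ 2 / C ^ 2 * (1 + ((l / l') ^ 2 - 1) * C ^ 2) := by
    rw [mul_pow, div_pow Z, hZ]
    field_simp
    ring
  rw [e1, add_sub_cancel]
  field_simp

/-- The limit has to be computed: at both endpoints the formula takes the spurious value l'/2,
because tan(±π/2) is 0 by convention. The integrals below therefore use boundary limits. -/
theorem tendsto_yoccozMap_zero (hl : 0 < l) (hl' : 0 < l') :
    Filter.Tendsto (yoccozMap l l') (𝓝[>] 0) (𝓝 0) := by
  have hpi := Real.pi_pos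
  have h1 : Filter.Tendsto (fun s : ℝ => Real.pi * (s / l - 1 / 2)) (𝓝[>] 0)
      (𝓝[>] (-(Real.pi / 2))) := by
    refine tendsto_nhdsWithin_of_tendsto_nhds_of_eventually_within _ ?_ ?_
    · have : Continuous fun s : ℝ => Real.pi * (s / l - 1 / 2) := by fun_prop
      have h := this.tendsto 0
      simp only [zero_div, zero_sub] at h
      rw [show Real.pi * -(1 / 2) = -(Real.pi / 2) by ring] at h
      exact h.mono_left nhdsWithin_le_nhds
    · filter_upwards [Ioo_mem_nhdsGT hl] with s hs
      exact (angle_mem_Ioo hs).1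
  have h2 := (Real.tendsto_arctan_atBot.mono_right nhdsWithin_le_nhds).comp
    ((Real.tendsto_tan_neg_pi_div_two.comp h1).const_mul_atBot (div_pos hl' hl))
  have h3 := ((h2.div_const Real.pi).const_add (1 / 2)).const_mul l'
  have e : l' * (1 / 2 + -(Real.pi / 2) / Real.pi) = 0 := by field_simp; ring
  rw [e] at h3
  exact h3

theorem tendsto_yoccozMap_right (hl : 0 < l) (hl' : 0 < l') :
    Filter.Tendsto (yoccozMap l l') (𝓝[<] l) (𝓝 l') := by
  have hpi := Real.pi_pos
  have h1 : Filter.Tendsto (fun s : ℝ => Real.pi * (s / l - 1 / 2)) (𝓝[<] l)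
      (𝓝[<] (Real.pi / 2)) := by
    refine tendsto_nhdsWithin_of_tendsto_nhds_of_eventually_within _ ?_ ?_
    · have : Continuous fun s : ℝ => Real.pi * (s / l - 1 / 2) := by fun_prop
      have h := this.tendsto l
      simp only [div_self hl.ne'] at h
      rw [show Real.pi * (1 - 1 / 2) = Real.pi / 2 by ring] at h
      exact h.mono_left nhdsWithin_le_nhds
    · filter_upwards [Ioo_mem_nhdsLT hl] with s hs
      exact (angle_mem_Ioo hs).2
  have h2 := (Real.tendsto_arctan_atTop.mono_right nhdsWithin_le_nhds).comp
    ((Real.tendsto_tan_pi_div_two.comp h1).const_mul_atTop (div_pos hl' hl))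
  have h3 := ((h2.div_const Real.pi).const_add (1 / 2)).const_mul l'
  have e : l' * (1 / 2 + Real.pi / 2 / Real.pi) = l' := by field_simp; ring
  rw [e] at h3
  exact h3

theorem integral_one_add_yoccozBump (hl' : 0 < l') {s : ℝ} (hs : s ∈ Set.Ioo 0 l) :
    ∫ t in (0 : ℝ)..s, (1 + yoccozBump l l' t) = yoccozMap l l' s := by
  have hl : 0 < l := hs.1.trans hs.2
  rw [intervalIntegral.integral_eq_sub_of_hasDerivAt_of_tendsto hs.1
    (fun t ht => hasDerivAt_yoccozMap hl' ⟨ht.1, ht.2.trans hs.2⟩)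
    ((continuous_const.add (continuous_yoccozBump hl hl')).intervalIntegrable _ _)
    (tendsto_yoccozMap_zero hl hl')
    ((hasDerivAt_yoccozMap hl' hs).continuousAt.tendsto.mono_left nhdsWithin_le_nhds), sub_zero]

theorem integral_one_add_yoccozBump_full (hl : 0 < l) (hl' : 0 < l') :
    ∫ t in (0 : ℝ)..l, (1 + yoccozBump l l' t) = l' := by
  rw [intervalIntegral.integral_eq_sub_of_hasDerivAt_of_tendsto hl
    (fun t ht => hasDerivAt_yoccozMap hl' ht)
    ((continuous_const.add (continuous_yoccozBump hl hl')).intervalIntegrable _ _)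
    (tendsto_yoccozMap_zero hl hl') (tendsto_yoccozMap_right hl hl'), sub_zero]

theorem integral_yoccozBump (hl' : 0 < l') {s : ℝ} (hs : s ∈ Set.Ioo 0 l) :
    ∫ t in (0 : ℝ)..s, yoccozBump l l' t = yoccozMap l l' s - s := by
  have hl : 0 < l := hs.1.trans hs.2
  have h := integral_one_add_yoccozBump hl' hs
  rw [intervalIntegral.integral_add (continuous_const.intervalIntegrable _ _)
    ((continuous_yoccozBump hl hl').intervalIntegrable _ _)] at h
  simp at h
  linarith

theorem integral_yoccozBump_of_nonpos (hl : 0 < l) {s : ℝ} (hs : s ≤ 0) :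
    ∫ t in (0 : ℝ)..s, yoccozBump l l' t = 0 := by
  refine intervalIntegral.integral_zero_ae (Filter.Eventually.of_forall fun t ht => ?_)
  rw [Set.uIoc_of_ge hs] at ht
  exact yoccozBump_of_nonpos hl ht.2

theorem integral_yoccozBump_of_ge (hl : 0 < l) (hl' : 0 < l') {s : ℝ} (hs : l ≤ s) :
    ∫ t in (0 : ℝ)..s, yoccozBump l l' t = l' - l := by
  have hi := fun a b => (continuous_yoccozBump hl hl').intervalIntegrable (μ := MeasureTheory.volume) a b
  rw [← intervalIntegral.integral_add_adjacent_intervals (hi 0 l) (hi l s)]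
  have h1 : ∫ t in l..s, yoccozBump l l' t = 0 := by
    refine intervalIntegral.integral_zero_ae (Filter.Eventually.of_forall fun t ht => ?_)
    rw [Set.uIoc_of_le hs] at ht
    exact yoccozBump_of_ge hl ht.1.le
  have h := integral_one_add_yoccozBump_full hl hl'
  rw [intervalIntegral.integral_add (continuous_const.intervalIntegrable _ _) (hi _ _)] at h
  simp at h
  rw [h1]
  linarith

end Yoccoz

theorem abs_div_sq_sub_one_le {u v η : ℝ} (hu : 0 < u) (hv : 0 < v) (hη0 : 0 ≤ η) (hη1 : η ≤ 1)
    (h1 : v ≤ (1 + η) * u) (h2 : u ≤ (1 + η) * v) : |(v / u) ^ 2 - 1| ≤ 3 * η := by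
  have h3 : v / u ≤ 1 + η := (div_le_iff₀ hu).2 h1
  have h4 : 1 ≤ (1 + η) * (v / u) := by
    rw [← mul_div_assoc, le_div_iff₀ hu, one_mul]; exact h2
  set q := v / u
  have hq : 0 < q := div_pos hv hu
  have h5 : 1 - η ≤ q := by nlinarith
  rw [abs_le]
  constructor <;> nlinarith

theorem UnitAddCircle.coe_add_intCast (t : ℝ) (n : ℤ) :
    ((t + n : ℝ) : UnitAddCircle) = t := by
  have h : ((n : ℝ) : UnitAddCircle) = 0 := (AddCircle.coe_eq_zero_iff (1 : ℝ)).2 ⟨n, by simp⟩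
  rw [AddCircle.coe_add, h, add_zero]

/-! ### The circle derivative as a sum of bumps, and its integral -/

section Bumps

variable {X : Type*} {l l' a : X → ℝ}

/-- The `1`-periodic function equal to `yoccozBump (l x) (l' x) (t - a x)` for `t ∈ [0, 1]`. -/
noncomputable def periodicBump (l l' a : X → ℝ) (x : X) (t : ℝ) : ℝ :=
  yoccozBump (l x) (l' x) (Int.fract t - a x)

theorem periodicBump_add_one (x : X) (t : ℝ) :
    periodicBump l l' a x (t + 1) = periodicBump l l' a x t := by
  simp [periodicBump]

theorem periodicBump_of_mem_Icc (hl0 : ∀ x, 0 < l x) (ha0 : ∀ x, 0 ≤ a x)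
    (ha1 : ∀ x, a x + l x ≤ 1) (x : X) {t : ℝ} (ht : t ∈ Set.Icc (0 : ℝ) 1) :
    periodicBump l l' a x t = yoccozBump (l x) (l' x) (t - a x) := by
  rcases ht.2.eq_or_lt with h | h
  · subst h
    rw [periodicBump, Int.fract_one, yoccozBump_of_nonpos (hl0 x) (by linarith [ha0 x]),
      yoccozBump_of_ge (hl0 x) (by linarith [ha1 x])]
  · rw [periodicBump, Int.fract_eq_self.2 ⟨ht.1, h⟩]

theorem continuous_periodicBump (hl0 : ∀ x, 0 < l x) (hl0' : ∀ x, 0 < l' x) (ha0 : ∀ x, 0 ≤ a x)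
    (ha1 : ∀ x, a x + l x ≤ 1) (x : X) : Continuous (periodicBump l l' a x) := by
  have hc := continuous_yoccozBump (hl0 x) (hl0' x)
  refine ContinuousOn.comp_fract (s := fun t : ℝ => t)
    (f := fun _ τ => yoccozBump (l x) (l' x) (τ - a x)) ?_ continuous_id fun s => ?_
  · refine Continuous.continuousOn ?_
    exact hc.comp (continuous_snd.sub continuous_const)
  · rw [yoccozBump_of_nonpos (hl0 x) (by linarith [ha0 x]),
      yoccozBump_of_ge (hl0 x) (by linarith [ha1 x])]

theorem exists_periodicBump_eq_zero [Nonempty X] (hl0 : ∀ x, 0 < l x)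
    (hdisj : ∀ x y, x ≠ y → a x + l x ≤ a y ∨ a y + l y ≤ a x) (t : ℝ) :
    ∃ x, ∀ y, y ≠ x → periodicBump l l' a y t = 0 := by
  by_cases h : ∃ x, periodicBump l l' a x t ≠ 0
  · obtain ⟨x, hx⟩ := h
    have hmem : ∀ y, periodicBump l l' a y t ≠ 0 →
        a y < Int.fract t ∧ Int.fract t < a y + l y := by
      intro y hy
      constructor
      · by_contra hcon
        exact hy (yoccozBump_of_nonpos (hl0 y) (by linarith))
      · by_contra hcon
        exact hy (yoccozBump_of_ge (hl0 y) (by linarith))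
    refine ⟨x, fun y hyx => ?_⟩
    by_contra hy
    have h1 := hmem x hx
    have h2 := hmem y hy
    rcases hdisj y x hyx with h | h <;> linarith
  · push Not at h
    exact ⟨Classical.arbitrary X, fun y _ => h y⟩

/-- The derivative of the circle map sending each interval `(a x, a x + l x)` to an interval of
length `l' x` by a Yoccoz diffeomorphism. -/
noncomputable def intervalDeriv (l l' a : X → ℝ) (t : ℝ) : ℝ :=
  1 + ∑' x, periodicBump l l' a x t

theorem exists_hasSum_periodicBump [Nonempty X] (hl0 : ∀ x, 0 < l x)
    (hdisj : ∀ x y, x ≠ y → a x + l x ≤ a y ∨ a y + l y ≤ a x) (t : ℝ) :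
    ∃ x, (∀ y, y ≠ x → periodicBump l l' a y t = 0) ∧
      HasSum (fun y => periodicBump l l' a y t) (periodicBump l l' a x t) ∧
      intervalDeriv l l' a t = 1 + periodicBump l l' a x t := by
  obtain ⟨x, hx⟩ := exists_periodicBump_eq_zero (l' := l') hl0 hdisj t
  have hs := hasSum_single x hx
  exact ⟨x, hx, hs, by rw [intervalDeriv, hs.tsum_eq]⟩

theorem intervalDeriv_add_one (t : ℝ) : intervalDeriv l l' a (t + 1) = intervalDeriv l l' a t := by
  simp [intervalDeriv, periodicBump_add_one]

theorem abs_periodicBump_le (hl0 : ∀ x, 0 < l x) (hl0' : ∀ x, 0 < l' x) (x : X) (t : ℝ) :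
    |periodicBump l l' a x t| ≤ |(l' x / l x) ^ 2 - 1| :=
  abs_yoccozBump_le (hl0 x) (hl0' x) _

theorem intervalDeriv_pos [Nonempty X] (hl0 : ∀ x, 0 < l x) (hl0' : ∀ x, 0 < l' x)
    (hdisj : ∀ x y, x ≠ y → a x + l x ≤ a y ∨ a y + l y ≤ a x) (t : ℝ) :
    0 < intervalDeriv l l' a t := by
  obtain ⟨x, -, -, h⟩ := exists_hasSum_periodicBump (l' := l') hl0 hdisj t
  rw [h]
  have : -1 < periodicBump l l' a x t := neg_one_lt_yoccozBump (hl0 x) (hl0' x) _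
  linarith

theorem abs_intervalDeriv_sub_one_le [Nonempty X] (hl0 : ∀ x, 0 < l x) (hl0' : ∀ x, 0 < l' x)
    (hdisj : ∀ x y, x ≠ y → a x + l x ≤ a y ∨ a y + l y ≤ a x) {η : ℝ}
    (hη : ∀ x, |(l' x / l x) ^ 2 - 1| ≤ η) (t : ℝ) :
    |intervalDeriv l l' a t - 1| ≤ η := by
  obtain ⟨x, -, -, h⟩ := exists_hasSum_periodicBump (l' := l') hl0 hdisj t
  rw [h, add_sub_cancel_left]
  exact (abs_periodicBump_le hl0 hl0' x t).trans (hη x)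

/-- The bumps have disjoint supports and all but finitely many are below any given height, so the
finite partial sums converge uniformly. -/
theorem continuous_intervalDeriv [Nonempty X] (hl0 : ∀ x, 0 < l x) (hl0' : ∀ x, 0 < l' x)
    (ha0 : ∀ x, 0 ≤ a x) (ha1 : ∀ x, a x + l x ≤ 1)
    (hdisj : ∀ x y, x ≠ y → a x + l x ≤ a y ∨ a y + l y ≤ a x)
    (hfin : ∀ η : ℝ, 0 < η → {x | η < |(l' x / l x) ^ 2 - 1|}.Finite) :
    Continuous (intervalDeriv l l' a) := by
  refine continuous_const.add ?_
  have hu : TendstoUniformly (fun (s : Finset X) (t : ℝ) => ∑ x ∈ s, periodicBump l l' a x t)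
      (fun t => ∑' x, periodicBump l l' a x t) Filter.atTop := by
    rw [Metric.tendstoUniformly_iff]
    intro ε hε
    filter_upwards [Filter.eventually_ge_atTop (hfin (ε / 2) (half_pos hε)).toFinset] with s hs t
    obtain ⟨x, hx, hsum, -⟩ := exists_hasSum_periodicBump (l' := l') hl0 hdisj t
    rw [hsum.tsum_eq, Real.dist_eq]
    by_cases hxs : x ∈ s
    · rw [Finset.sum_eq_single_of_mem x hxs fun y _ hy => hx y hy]
      simpa using hε
    · rw [Finset.sum_eq_zero fun y hy => hx y (by rintro rfl; exact hxs hy), sub_zero]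
      refine (abs_periodicBump_le hl0 hl0' x t).trans_lt ?_
      have : ¬ ε / 2 < |(l' x / l x) ^ 2 - 1| := fun h =>
        hxs (hs ((hfin (ε / 2) (half_pos hε)).mem_toFinset.2 h))
      linarith
  exact hu.continuous (Filter.Eventually.of_forall fun s =>
    continuous_finsetSum _ fun x _ => continuous_periodicBump hl0 hl0' ha0 ha1 x).frequently

theorem exists_forall_abs_div_sq_sub_one_le
    (hfin : ∀ η : ℝ, 0 < η → {x | η < |(l' x / l x) ^ 2 - 1|}.Finite) :
    ∃ C : ℝ, ∀ x, |(l' x / l x) ^ 2 - 1| ≤ C := by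
  obtain ⟨C, hC⟩ := ((hfin 1 one_pos).image fun x => |(l' x / l x) ^ 2 - 1|).bddAbove
  refine ⟨max 1 C, fun x => ?_⟩
  by_cases h : 1 < |(l' x / l x) ^ 2 - 1|
  · exact (hC ⟨x, h, rfl⟩).trans (le_max_right _ _)
  · exact (not_lt.1 h).trans (le_max_left _ _)

/-- Dominated convergence: at each point at most one bump is nonzero, so a common bound for the
bumps bounds all partial sums. -/
theorem hasSum_integral_periodicBump [Nonempty X] [Countable X] (hl0 : ∀ x, 0 < l x)
    (hl0' : ∀ x, 0 < l' x) (ha0 : ∀ x, 0 ≤ a x) (ha1 : ∀ x, a x + l x ≤ 1)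
    (hdisj : ∀ x y, x ≠ y → a x + l x ≤ a y ∨ a y + l y ≤ a x)
    (hfin : ∀ η : ℝ, 0 < η → {x | η < |(l' x / l x) ^ 2 - 1|}.Finite) (t : ℝ) :
    HasSum (fun x => ∫ u in (0 : ℝ)..t, periodicBump l l' a x u)
      ((∫ u in (0 : ℝ)..t, intervalDeriv l l' a u) - t) := by
  obtain ⟨C, hC⟩ := exists_forall_abs_div_sq_sub_one_le hfin
  have hcb := fun x => continuous_periodicBump (l' := l') hl0 hl0' ha0 ha1 x
  have hD := continuous_intervalDeriv hl0 hl0' ha0 ha1 hdisj hfin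
  have h1 : (∫ u in (0 : ℝ)..t, intervalDeriv l l' a u) - t =
      ∫ u in (0 : ℝ)..t, (intervalDeriv l l' a u - 1) := by
    rw [intervalIntegral.integral_sub (hD.intervalIntegrable _ _)
      (continuous_const.intervalIntegrable _ _)]
    simp
  rw [h1]
  have h2 : (fun s : Finset X => ∑ x ∈ s, ∫ u in (0 : ℝ)..t, periodicBump l l' a x u) =
      fun s => ∫ u in (0 : ℝ)..t, ∑ x ∈ s, periodicBump l l' a x u := by
    funext s
    rw [intervalIntegral.integral_finsetSum fun x _ => (hcb x).intervalIntegrable _ _]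
  rw [HasSum, SummationFilter.unconditional_filter, h2]
  refine intervalIntegral.tendsto_integral_filter_of_dominated_convergence (fun _ => C)
    (Filter.Eventually.of_forall fun s =>
      (continuous_finsetSum _ fun x _ => hcb x).aestronglyMeasurable)
    (Filter.Eventually.of_forall fun s => Filter.Eventually.of_forall fun u _ => ?_)
    (continuous_const.intervalIntegrable _ _)
    (Filter.Eventually.of_forall fun u _ => ?_)
  · obtain ⟨x, hx, -, -⟩ := exists_hasSum_periodicBump (l' := l') hl0 hdisj u
    rw [Real.norm_eq_abs]
    by_cases hxs : x ∈ s
    · rw [Finset.sum_eq_single_of_mem x hxs fun y _ hy => hx y hy]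
      exact (abs_periodicBump_le hl0 hl0' x u).trans (hC x)
    · rw [Finset.sum_eq_zero fun y hy => hx y (by rintro rfl; exact hxs hy), abs_zero]
      exact (abs_nonneg _).trans (hC x)
  · obtain ⟨x, hx, hsum, h⟩ := exists_hasSum_periodicBump (l' := l') hl0 hdisj u
    rw [h, add_sub_cancel_left]
    exact hsum

theorem integral_periodicBump (hl0 : ∀ x, 0 < l x) (hl0' : ∀ x, 0 < l' x) (ha0 : ∀ x, 0 ≤ a x)
    (ha1 : ∀ x, a x + l x ≤ 1) (x : X) {t : ℝ} (ht : t ∈ Set.Icc (0 : ℝ) 1) :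
    ∫ u in (0 : ℝ)..t, periodicBump l l' a x u =
      ∫ u in (0 : ℝ)..(t - a x), yoccozBump (l x) (l' x) u := by
  have h1 : ∫ u in (0 : ℝ)..t, periodicBump l l' a x u =
      ∫ u in (0 : ℝ)..t, yoccozBump (l x) (l' x) (u - a x) := by
    refine intervalIntegral.integral_congr fun u hu => ?_
    rw [Set.uIcc_of_le ht.1] at hu
    exact periodicBump_of_mem_Icc hl0 ha0 ha1 x ⟨hu.1, hu.2.trans ht.2⟩
  have hi := fun r s => (continuous_yoccozBump (hl0 x) (hl0' x)).intervalIntegrable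
    (μ := MeasureTheory.volume) r s
  rw [h1, intervalIntegral.integral_comp_sub_right (fun u => yoccozBump (l x) (l' x) u),
    ← intervalIntegral.integral_interval_sub_left (hi 0 (t - a x)) (hi 0 (0 - a x)),
    integral_yoccozBump_of_nonpos (s := 0 - a x) (hl0 x) (by linarith [ha0 x]), sub_zero]

theorem integral_intervalDeriv_one [Nonempty X] [Countable X] (hl0 : ∀ x, 0 < l x)
    (hl0' : ∀ x, 0 < l' x) (hl : HasSum l 1) (hl' : HasSum l' 1) (ha0 : ∀ x, 0 ≤ a x)
    (ha1 : ∀ x, a x + l x ≤ 1) (hdisj : ∀ x y, x ≠ y → a x + l x ≤ a y ∨ a y + l y ≤ a x)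
    (hfin : ∀ η : ℝ, 0 < η → {x | η < |(l' x / l x) ^ 2 - 1|}.Finite) :
    ∫ u in (0 : ℝ)..1, intervalDeriv l l' a u = 1 := by
  have h := hasSum_integral_periodicBump hl0 hl0' ha0 ha1 hdisj hfin 1
  have h2 : ∀ x, ∫ u in (0 : ℝ)..1, periodicBump l l' a x u = l' x - l x := by
    intro x
    rw [integral_periodicBump hl0 hl0' ha0 ha1 x ⟨zero_le_one, le_rfl⟩,
      integral_yoccozBump_of_ge (hl0 x) (hl0' x) (by linarith [ha1 x])]
  simp_rw [h2] at h
  have := h.unique (hl'.sub hl)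
  linarith

/-- Up to the point s inside the arc of x, each earlier arc contributes its full change of length
`l' y - l y`, later arcs nothing, and x itself `yoccozMap - s`. Summing replaces the weight of [p,
x) for `l` by that for `l'`. -/
theorem integral_intervalDeriv_arcWeight [Nonempty X] [Countable X] (c : CyclicOrder X) (p : X)
    (hl0 : ∀ x, 0 < l x) (hl0' : ∀ x, 0 < l' x) (hl : HasSum l 1) (hl' : Summable l')
    (hdisj : ∀ x y, x ≠ y → c.arcWeight l p x + l x ≤ c.arcWeight l p y ∨
      c.arcWeight l p y + l y ≤ c.arcWeight l p x)
    (hfin : ∀ η : ℝ, 0 < η → {x | η < |(l' x / l x) ^ 2 - 1|}.Finite) (x : X) {s : ℝ}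
    (hs : s ∈ Set.Ioo 0 (l x)) :
    ∫ u in (0 : ℝ)..(c.arcWeight l p x + s), intervalDeriv l l' (c.arcWeight l p) u =
      c.arcWeight l' p x + yoccozMap (l x) (l' x) s := by
  classical
  have ha0 := fun x => c.arcWeight_nonneg hl0 p x
  have ha1 := fun x => c.arcWeight_add_le_one hl0 hl p x
  have h := hasSum_integral_periodicBump hl0 hl0' ha0 ha1 hdisj hfin (c.arcWeight l p x + s)
  have hmem : c.arcWeight l p x + s ∈ Set.Icc (0 : ℝ) 1 :=
    ⟨by linarith [ha0 x, hs.1], by linarith [ha1 x, hs.2]⟩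
  have h2 : ∀ y, ∫ u in (0 : ℝ)..(c.arcWeight l p x + s),
      periodicBump l l' (c.arcWeight l p) y u =
      ((if c.cut p y x = 1 then l' y else 0) - if c.cut p y x = 1 then l y else 0) +
        if y = x then yoccozMap (l x) (l' x) s - s else 0 := by
    intro y
    rw [integral_periodicBump hl0 hl0' ha0 ha1 y hmem]
    by_cases hyx : y = x
    · subst hyx
      rw [add_sub_cancel_left, integral_yoccozBump (hl0' y) hs]
      simp [CyclicOrder.cut_self]
    by_cases hcut : c.cut p y x = 1
    · have := c.arcWeight_add_le hl0 hl.summable hcut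
      rw [integral_yoccozBump_of_ge (hl0 y) (hl0' y) (by linarith [hs.1])]
      simp [hcut, hyx]
    · have hcut' : c.cut p x y = 1 := by
        have h1 := c.cut_swap p x y
        have h2 := c.cut_ne_zero p hyx
        revert h1 h2 hcut
        generalize c.cut p x y = s
        generalize c.cut p y x = t
        revert s t
        decide
      have := c.arcWeight_add_le hl0 hl.summable hcut'
      rw [integral_yoccozBump_of_nonpos (hl0 y) (by linarith [hs.2])]
      simp [hcut, hyx]
  simp_rw [h2] at h
  have h3 := h.unique (((c.hasSum_arcWeight hl0' hl' p x).sub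
    (c.hasSum_arcWeight hl0 hl.summable p x)).add (hasSum_ite_eq x _))
  linarith

/-- The arcs have total length 1, so their complement in (0, 1) is null and contains no nonempty
open set. -/
theorem dense_iUnion_circleIoo [Countable X] (hl0 : ∀ x, 0 < l x)
    (hl : HasSum l 1) (ha0 : ∀ x, 0 ≤ a x) (ha1 : ∀ x, a x + l x ≤ 1)
    (hdisj : ∀ x y, x ≠ y → a x + l x ≤ a y ∨ a y + l y ≤ a x) :
    Dense (⋃ x, circleIoo (a x) (a x + l x)) := by
  set U : Set ℝ := ⋃ x, Set.Ioo (a x) (a x + l x) with hU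
  have hUsub : U ⊆ Set.Ioo 0 1 :=
    Set.iUnion_subset fun x => Set.Ioo_subset_Ioo (ha0 x) (ha1 x)
  have hUmeas : MeasurableSet U := MeasurableSet.iUnion fun x => measurableSet_Ioo
  have hvol : MeasureTheory.volume U = 1 := by
    rw [hU, MeasureTheory.measure_iUnion _ fun x => measurableSet_Ioo]
    · simp only [Real.volume_Ioo, add_sub_cancel_left]
      rw [← ENNReal.ofReal_tsum_of_nonneg (fun x => (hl0 x).le) hl.summable, hl.tsum_eq,
        ENNReal.ofReal_one]
    · intro x y hxy
      refine Set.disjoint_left.2 fun t h1 h2 => ?_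
      rcases hdisj x y hxy with h | h
      · linarith [h1.2, h2.1]
      · linarith [h2.2, h1.1]
  have hnull : MeasureTheory.volume (Set.Ioo 0 1 \ U) = 0 := by
    rw [MeasureTheory.measure_sdiff hUsub hUmeas.nullMeasurableSet (by simp [hvol]), hvol]
    simp
  have hcl : Set.Ioo (0 : ℝ) 1 ⊆ closure U := by
    intro t ht
    rw [mem_closure_iff]
    intro V hV htV
    by_contra hne
    have hsub : V ∩ Set.Ioo 0 1 ⊆ Set.Ioo 0 1 \ U := fun u hu =>
      ⟨hu.2, fun huU => hne ⟨u, hu.1, huU⟩⟩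
    exact ((hV.inter isOpen_Ioo).measure_pos MeasureTheory.volume ⟨t, htV, ht⟩).ne'
      (MeasureTheory.measure_mono_null hsub hnull)
  have hcl' : Set.Icc (0 : ℝ) 1 ⊆ closure U := by
    rw [← closure_Ioo zero_ne_one]
    exact closure_minimal hcl isClosed_closure
  have himage : (⋃ x, circleIoo (a x) (a x + l x)) = (fun t : ℝ => (t : UnitAddCircle)) '' U := by
    rw [hU, Set.image_iUnion]
    rfl
  rw [himage]
  intro ξ
  obtain ⟨t, ht, rfl⟩ := AddCircle.eq_coe_Ico ξ
  exact image_closure_subset_closure_image (AddCircle.continuous_mk' 1)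
    ⟨t, hcl' ⟨ht.1, ht.2.le⟩, rfl⟩

end Bumps

/-! ### The action on the circle -/

section Action

variable {G X : Type*} [Group G] [MulAction G X]

/-- The lift to `ℝ` of the circle map by which `g` permutes the arcs of lengths `l x`. -/
noncomputable def actionLift (c : CyclicOrder X) (l : X → ℝ) (p : X) (g : G) (t : ℝ) : ℝ :=
  c.arcWeight l p (g • p) +
    ∫ u in (0 : ℝ)..t, intervalDeriv l (fun x => l (g • x)) (c.arcWeight l p) u

/-- Translation by g preserves the cyclic order, hence carries the order cut at p to the one cut at
g•p; reindex the sum. -/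
theorem arcWeight_smul (c : CyclicOrder X) (hc : ∀ g : G, c.Preserves c (fun x => g • x))
    (l : X → ℝ) (g : G) (p x : X) :
    c.arcWeight (fun y => l (g • y)) p x = c.arcWeight l (g • p) (g • x) := by
  classical
  unfold CyclicOrder.arcWeight
  rw [← (MulAction.toPerm g).tsum_eq (fun y => if c.cut (g • p) y (g • x) = 1 then l y else 0)]
  simp only [MulAction.toPerm_apply, c.cut_smul hc]

theorem HasSum.smul_comp {l : X → ℝ} {r : ℝ} (hl : HasSum l r) (g : G) :
    HasSum (fun x => l (g • x)) r :=
  (MulAction.toPerm g).hasSum_iff.2 hl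

/-- Positive weights of total mass one that are asymptotically invariant under `G`. -/
structure IsAsymptoticWeight (G : Type*) {X : Type*} [Group G] [MulAction G X] (l : X → ℝ) :
    Prop where
  pos : ∀ x, 0 < l x
  hasSum : HasSum l 1
  finite : ∀ g : G, ∀ η : ℝ, 0 < η → {x | η < |(l (g • x) / l x) ^ 2 - 1|}.Finite

variable {l : X → ℝ}

theorem CyclicOrder.arcWeight_disjoint (c : CyclicOrder X) (hl : IsAsymptoticWeight G l) (p : X)
    (x y : X) (hxy : x ≠ y) : c.arcWeight l p x + l x ≤ c.arcWeight l p y ∨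
      c.arcWeight l p y + l y ≤ c.arcWeight l p x := by
  by_cases hcut : c.cut p x y = 1
  · exact Or.inl (c.arcWeight_add_le hl.pos hl.hasSum.summable hcut)
  · right
    refine c.arcWeight_add_le hl.pos hl.hasSum.summable ?_
    have h1 := c.cut_swap p x y
    have h2 := c.cut_ne_zero p hxy
    revert h1 h2 hcut
    generalize c.cut p x y = s
    generalize c.cut p y x = t
    revert s t
    decide

/-- The arc of length `l x`. -/
noncomputable def weightArc (c : CyclicOrder X) (l : X → ℝ) (p x : X) : Set UnitAddCircle :=
  circleIoo (c.arcWeight l p x) (c.arcWeight l p x + l x)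

theorem mem_weightArc (c : CyclicOrder X) (l : X → ℝ) (p x : X) {ξ : UnitAddCircle} :
    ξ ∈ weightArc c l p x ↔
      ∃ s ∈ Set.Ioo 0 (l x), ((c.arcWeight l p x + s : ℝ) : UnitAddCircle) = ξ := by
  constructor
  · rintro ⟨t, ht, rfl⟩
    exact ⟨t - c.arcWeight l p x, ⟨by linarith [ht.1], by linarith [ht.2]⟩, by simp⟩
  · rintro ⟨s, hs, rfl⟩
    exact ⟨_, ⟨by linarith [hs.1], by linarith [hs.2]⟩, rfl⟩

theorem dense_iUnion_weightArc [Countable X] (c : CyclicOrder X) (hl : IsAsymptoticWeight G l) (p : X) :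
    Dense (⋃ x, weightArc c l p x) :=
  dense_iUnion_circleIoo hl.pos hl.hasSum (c.arcWeight_nonneg hl.pos p)
    (c.arcWeight_add_le_one hl.pos hl.hasSum p) (c.arcWeight_disjoint hl p)

variable [Nonempty X]

theorem continuous_actionDeriv (c : CyclicOrder X) (hl : IsAsymptoticWeight G l) (p : X) (g : G) :
    Continuous (intervalDeriv l (fun x => l (g • x)) (c.arcWeight l p)) :=
  continuous_intervalDeriv hl.pos (fun _ => hl.pos _) (c.arcWeight_nonneg hl.pos p)
    (c.arcWeight_add_le_one hl.pos hl.hasSum p) (c.arcWeight_disjoint hl p) (hl.finite g)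

theorem hasDerivAt_actionLift (c : CyclicOrder X) (hl : IsAsymptoticWeight G l) (p : X) (g : G)
    (t : ℝ) : HasDerivAt (actionLift c l p g)
      (intervalDeriv l (fun x => l (g • x)) (c.arcWeight l p) t) t := by
  have hD := continuous_actionDeriv c hl p g
  exact (intervalIntegral.integral_hasDerivAt_right (hD.intervalIntegrable _ _)
    (hD.stronglyMeasurableAtFilter _ _) hD.continuousAt).const_add _

variable [Countable X]

/-- The derivative has integral 1 over a period because `l` and its translate by g have the same
total mass. -/
theorem actionLift_add_one (c : CyclicOrder X) (hl : IsAsymptoticWeight G l) (p : X) (g : G)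
    (t : ℝ) : actionLift c l p g (t + 1) = actionLift c l p g t + 1 := by
  have hD := continuous_actionDeriv c hl p g
  have hper : Function.Periodic
      (intervalDeriv l (fun x => l (g • x)) (c.arcWeight l p)) 1 := intervalDeriv_add_one
  have h1 := hper.intervalIntegral_add_eq t 0
  rw [zero_add, integral_intervalDeriv_one hl.pos (fun _ => hl.pos _) hl.hasSum
    (hl.hasSum.smul_comp g) (c.arcWeight_nonneg hl.pos p)
    (c.arcWeight_add_le_one hl.pos hl.hasSum p) (c.arcWeight_disjoint hl p) (hl.finite g)] at h1
  unfold actionLift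
  rw [← intervalIntegral.integral_add_adjacent_intervals (hD.intervalIntegrable 0 t)
    (hD.intervalIntegrable t (t + 1)), h1, add_assoc]

/-- The map of the circle by which `g` permutes the arcs of lengths `l x`. -/
noncomputable def actionMap (c : CyclicOrder X) (hl : IsAsymptoticWeight G l) (p : X) (g : G) :
    UnitAddCircle → UnitAddCircle :=
  Function.Periodic.lift (f := fun t : ℝ => (actionLift c l p g t : UnitAddCircle)) (c := 1)
    fun t => by
      simp only [actionLift_add_one c hl]
      exact AddCircle.coe_add_period 1 _

theorem actionMap_coe (c : CyclicOrder X) (hl : IsAsymptoticWeight G l) (p : X) (g : G) (t : ℝ) :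
    actionMap c hl p g (t : UnitAddCircle) = (actionLift c l p g t : UnitAddCircle) := rfl

theorem continuous_actionMap (c : CyclicOrder X) (hl : IsAsymptoticWeight G l) (p : X) (g : G) :
    Continuous (actionMap c hl p g) := by
  refine (QuotientAddGroup.isQuotientMap_mk _).continuous_iff.2 ?_
  have h : Continuous (actionLift c l p g) :=
    continuous_iff_continuousAt.2 fun t => (hasDerivAt_actionLift c hl p g t).continuousAt
  exact (AddCircle.continuous_mk' 1).comp h

/-- The derivative of `actionMap`. -/
noncomputable def actionMapDeriv (c : CyclicOrder X) (l : X → ℝ) (p : X) (g : G) :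
    UnitAddCircle → ℝ :=
  Function.Periodic.lift (f := intervalDeriv l (fun x => l (g • x)) (c.arcWeight l p)) (c := 1)
    intervalDeriv_add_one

theorem hasCircleDeriv_actionMap (c : CyclicOrder X) (hl : IsAsymptoticWeight G l) (p : X)
    (g : G) : HasCircleDeriv (actionMap c hl p g) (actionMapDeriv c l p g) :=
  ⟨actionLift c l p g, fun _ => rfl, hasDerivAt_actionLift c hl p g⟩

theorem isC1Pos_actionMap (c : CyclicOrder X) (hl : IsAsymptoticWeight G l) (p : X) (g : G) :
    IsC1Pos (actionMap c hl p g) := by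
  refine ⟨_, hasCircleDeriv_actionMap c hl p g, ?_, fun ξ => ?_⟩
  · exact (QuotientAddGroup.isQuotientMap_mk _).continuous_iff.2 (continuous_actionDeriv c hl p g)
  · induction ξ using QuotientAddGroup.induction_on with
    | H t => exact intervalDeriv_pos hl.pos (fun _ => hl.pos _) (c.arcWeight_disjoint hl p) t

/-- The constant in `actionLift` is the weight of [p, g•p), as the arc of p starts at 0. The
integral adds the weight of [g•p, g•x), and changing the cut gives that of [p, g•x) modulo an
integer. -/
theorem actionMap_coe_add (c : CyclicOrder X) (hc : ∀ g : G, c.Preserves c (fun x => g • x))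
    (hl : IsAsymptoticWeight G l) (p : X) (g : G) (x : X) {s : ℝ} (hs : s ∈ Set.Ioo 0 (l x)) :
    actionMap c hl p g ((c.arcWeight l p x + s : ℝ) : UnitAddCircle) =
      ((c.arcWeight l p (g • x) + yoccozMap (l x) (l (g • x)) s : ℝ) : UnitAddCircle) := by
  obtain ⟨n, hn⟩ := c.exists_arcWeight_eq hl.pos hl.hasSum p (g • p) (g • x)
  rw [actionMap_coe, actionLift, integral_intervalDeriv_arcWeight c p hl.pos (fun _ => hl.pos _)
    hl.hasSum (hl.hasSum.smul_comp g).summable (c.arcWeight_disjoint hl p) (hl.finite g) x hs,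
    arcWeight_smul c hc, hn,
    ← UnitAddCircle.coe_add_intCast (c.arcWeight l p (g • x) + yoccozMap (l x) (l (g • x)) s) n]
  congr 1
  ring

theorem actionMap_mul (c : CyclicOrder X) (hc : ∀ g : G, c.Preserves c (fun x => g • x))
    (hl : IsAsymptoticWeight G l) (p : X) (g h : G) (ξ : UnitAddCircle) :
    actionMap c hl p (g * h) ξ = actionMap c hl p g (actionMap c hl p h ξ) := by
  refine congrFun (Continuous.ext_on (dense_iUnion_weightArc c hl p)
    (continuous_actionMap c hl p _)
    ((continuous_actionMap c hl p g).comp (continuous_actionMap c hl p h)) fun ξ hξ => ?_) ξ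
  obtain ⟨x, hx⟩ := Set.mem_iUnion.1 hξ
  obtain ⟨s, hs, rfl⟩ := (mem_weightArc c l p x).1 hx
  rw [Function.comp_apply, actionMap_coe_add c hc hl p _ x hs, actionMap_coe_add c hc hl p _ x hs,
    actionMap_coe_add c hc hl p _ (h • x) (yoccozMap_mem_Ioo (hl.pos _) s),
    yoccozMap_comp (hl.pos _) (hl.pos _), mul_smul]

theorem actionMap_eq_self (c : CyclicOrder X) (hc : ∀ g : G, c.Preserves c (fun x => g • x))
    (hl : IsAsymptoticWeight G l) (p : X) {g : G} {x : X} (hg : g • x = x) {ξ : UnitAddCircle}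
    (hξ : ξ ∈ weightArc c l p x) : actionMap c hl p g ξ = ξ := by
  obtain ⟨s, hs, rfl⟩ := (mem_weightArc c l p x).1 hξ
  rw [actionMap_coe_add c hc hl p _ x hs, hg, yoccozMap_self hs]

theorem actionMap_one (c : CyclicOrder X) (hc : ∀ g : G, c.Preserves c (fun x => g • x))
    (hl : IsAsymptoticWeight G l) (p : X) (ξ : UnitAddCircle) :
    actionMap c hl p (1 : G) ξ = ξ := by
  refine congrFun (Continuous.ext_on (dense_iUnion_weightArc c hl p)
    (continuous_actionMap c hl p _) continuous_id fun ξ hξ => ?_) ξ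
  obtain ⟨x, hx⟩ := Set.mem_iUnion.1 hξ
  exact actionMap_eq_self c hc hl p (one_smul G x) hx

/-- The homeomorphism of the circle by which `g` permutes the arcs of lengths `l x`. -/
noncomputable def actionHomeo (c : CyclicOrder X) (hc : ∀ g : G, c.Preserves c (fun x => g • x))
    (hl : IsAsymptoticWeight G l) (p : X) (g : G) : UnitAddCircle ≃ₜ UnitAddCircle where
  toFun := actionMap c hl p g
  invFun := actionMap c hl p g⁻¹
  left_inv ξ := by rw [← actionMap_mul c hc, inv_mul_cancel, actionMap_one c hc]
  right_inv ξ := by rw [← actionMap_mul c hc, mul_inv_cancel, actionMap_one c hc]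
  continuous_toFun := continuous_actionMap c hl p g
  continuous_invFun := continuous_actionMap c hl p g⁻¹

/-- The action of `G` on the circle by `C¹` diffeomorphisms permuting the arcs of lengths `l x`. -/
noncomputable def actionHom (c : CyclicOrder X) (hc : ∀ g : G, c.Preserves c (fun x => g • x))
    (hl : IsAsymptoticWeight G l) (p : X) : G →* DiffC1Plus :=
  MonoidHom.mk' (fun g => ⟨actionHomeo c hc hl p g, isC1Pos_actionMap c hl p g,
    isC1Pos_actionMap c hl p g⁻¹⟩) fun g h =>
    Subtype.ext (Homeomorph.ext fun ξ => actionMap_mul c hc hl p g h ξ)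

theorem actionHom_apply (c : CyclicOrder X) (hc : ∀ g : G, c.Preserves c (fun x => g • x))
    (hl : IsAsymptoticWeight G l) (p : X) (g : G) (ξ : UnitAddCircle) :
    (actionHom c hc hl p g).1 ξ = actionMap c hl p g ξ := rfl

theorem mapsTo_weightArc (c : CyclicOrder X) (hc : ∀ g : G, c.Preserves c (fun x => g • x))
    (hl : IsAsymptoticWeight G l) (p : X) (g : G) (x : X) :
    Set.MapsTo (actionMap c hl p g) (weightArc c l p x) (weightArc c l p (g • x)) := by
  intro ξ hξ
  obtain ⟨s, hs, rfl⟩ := (mem_weightArc c l p x).1 hξ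
  rw [actionMap_coe_add c hc hl p _ x hs]
  exact (mem_weightArc c l p _).2 ⟨_, yoccozMap_mem_Ioo (hl.pos _) s, rfl⟩

theorem isRealisation_actionHom (c : CyclicOrder X)
    (hc : ∀ g : G, c.Preserves c (fun x => g • x)) (hl : IsAsymptoticWeight G l) (p : X) :
    IsRealisation c (actionHom c hc hl p) (c.arcWeight l p)
      (fun x => c.arcWeight l p x + l x) (weightArc c l p) := by
  have h0 := c.arcWeight_nonneg hl.pos p
  have h1 := c.arcWeight_add_le_one hl.pos hl.hasSum p
  have hpos := hl.pos
  have hmono : ∀ x y, c.cut p x y = 1 → c.arcWeight l p x + l x ≤ c.arcWeight l p y :=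
    fun x y h => c.arcWeight_add_le hl.pos hl.hasSum.summable h
  refine ⟨fun x => lt_add_of_pos_right _ (hpos x), fun x => ?_, fun _ => rfl, fun x y hxy => ?_,
    dense_iUnion_weightArc c hl p, ?_, ?_, fun g x => ?_, fun g x hg ξ hξ => ?_⟩
  · linarith [h0 x, h1 x]
  · rw [← Set.disjoint_iff_inter_eq_empty, Set.disjoint_left]
    rintro _ ⟨t, ht, rfl⟩ ⟨u, hu, htu⟩
    have htu' : u = t := by
      refine (AddCircle.coe_eq_coe_iff_of_mem_Ico (p := (1 : ℝ)) (a := 0) ⟨?_, ?_⟩ ⟨?_, ?_⟩).1 htu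
      · linarith [h0 y, hu.1]
      · linarith [h1 y, hu.2]
      · linarith [h0 x, ht.1]
      · linarith [h1 x, ht.2]
    subst htu'
    rcases c.arcWeight_disjoint hl p x y hxy with h | h
    · linarith [ht.2, hu.1]
    · linarith [ht.1, hu.2]
  · refine c.preserves_circle_of_monotone p (fun x y => ?_) fun x y h => ?_
    · rw [abs_lt]
      constructor <;> linarith [h0 x, h0 y, h1 x, h1 y, hpos x, hpos y]
    · linarith [hmono x y h, hpos x]
  · refine c.preserves_circle_of_monotone p (fun x y => ?_) fun x y h => ?_
    · rw [abs_lt]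
      constructor <;> linarith [h0 x, h0 y, h1 x, h1 y, hpos x, hpos y]
    · linarith [hmono x y h, hpos y]
  -- Surjectivity onto the arc comes from applying the inclusion to g⁻¹.
  · refine Set.Subset.antisymm (mapsTo_weightArc c hc hl p g x).image_subset fun ξ hξ => ?_
    have h := mapsTo_weightArc c hc hl p g⁻¹ (g • x) hξ
    rw [inv_smul_smul] at h
    refine ⟨_, h, ?_⟩
    rw [actionHom_apply, ← actionMap_mul c hc, mul_inv_cancel, actionMap_one c hc]
  · exact actionMap_eq_self c hc hl p hg hξ

theorem abs_D_actionHom_sub_one_le (c : CyclicOrder X)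
    (hc : ∀ g : G, c.Preserves c (fun x => g • x)) (hl : IsAsymptoticWeight G l) (p : X) {g : G}
    {η : ℝ} (hη : ∀ x, |(l (g • x) / l x) ^ 2 - 1| ≤ η) (ξ : UnitAddCircle) :
    |DiffC1Plus.D (actionHom c hc hl p g) ξ - 1| ≤ η := by
  have h : DiffC1Plus.D (actionHom c hc hl p g) = actionMapDeriv c l p g :=
    (DiffC1Plus.hasCircleDeriv _).unique (hasCircleDeriv_actionMap c hl p g)
  rw [h]
  induction ξ using QuotientAddGroup.induction_on with
  | H t =>
    exact abs_intervalDeriv_sub_one_le hl.pos (fun _ => hl.pos _) (c.arcWeight_disjoint hl p) hη t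

end Action

/-! ### Conclusion -/

theorem SubexpOrbitGrowth.exists_isAsymptoticWeight {G X : Type*} [Group G] [Countable G]
    [MulAction G X] [Countable X] [Nonempty X] (hX : SubexpOrbitGrowth G X) (S : Finset G) {ε : ℝ}
    (hε : 0 < ε) : ∃ l : X → ℝ, IsAsymptoticWeight G l ∧
      ∀ g ∈ S, ∀ x, |(l (g • x) / l x) ^ 2 - 1| ≤ ε := by
  classical
  have hθ : ∀ η : ℝ, 0 < η → ∃ θ : ℝ, 0 < θ ∧ θ ≤ 1 ∧ 3 * θ ≤ η := fun η hη =>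
    ⟨min 1 (η / 3), by positivity, min_le_left _ _, by linarith [min_le_right 1 (η / 3)]⟩
  obtain ⟨δ, hδ0, hδ1, hδ⟩ := hθ ε hε
  -- The weights give only upper bounds on ratios; including the inverses supplies the lower bounds,
  -- by applying g⁻¹ at g•x.
  obtain ⟨l, hl0, hl, hfin, hS⟩ := hX.exists_weights (S ∪ S.image fun g => g⁻¹) hδ0
  refine ⟨l, ⟨hl0, hl, fun g η hη => ?_⟩, fun g hg x => ?_⟩
  · obtain ⟨θ, hθ0, hθ1, hθη⟩ := hθ η hη
    refine ((hfin g θ hθ0).union ((hfin g⁻¹ θ hθ0).preimage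
      (MulAction.injective g).injOn)).subset fun x hx => ?_
    by_contra hcon
    rw [Set.mem_union, not_or] at hcon
    have h1 : l (g • x) ≤ (1 + θ) * l x := not_lt.1 hcon.1
    have h2 : l (g⁻¹ • g • x) ≤ (1 + θ) * l (g • x) := not_lt.1 hcon.2
    rw [inv_smul_smul] at h2
    exact absurd ((abs_div_sq_sub_one_le (hl0 x) (hl0 _) hθ0.le hθ1 h1 h2).trans hθη)
      (not_le.2 hx)
  · have h1 := hS g (Finset.mem_union_left _ hg) x
    have h2 := hS g⁻¹ (Finset.mem_union_right _ (Finset.mem_image_of_mem _ hg)) (g • x)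
    rw [inv_smul_smul] at h2
    exact (abs_div_sq_sub_one_le (hl0 x) (hl0 _) hδ0.le hδ1 h1 h2).trans hδ

theorem theorem3p1 {G X : Type*} [Group G] [Countable G] [MulAction G X] [Countable X] [Nonempty X]
    (c : CyclicOrder X) (hc : ∀ g : G, c.Preserves c (fun x => g • x))
    (hX : SubexpOrbitGrowth G X) :
    (∃ (ρ : G →* DiffC1Plus) (a b : X → ℝ) (J : X → Set UnitAddCircle),
      IsRealisation c ρ a b J) ∧
    ∀ (S : Finset G) (ε : ℝ), 0 < ε →
      ∃ (ρ : G →* DiffC1Plus) (a b : X → ℝ) (J : X → Set UnitAddCircle),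
        IsRealisation c ρ a b J ∧
        ∀ s ∈ S, BddAbove (Set.range fun ξ => |DiffC1Plus.D (ρ s) ξ - 1|) ∧
          (⨆ ξ, |DiffC1Plus.D (ρ s) ξ - 1|) < ε := by
  obtain ⟨p⟩ := ‹Nonempty X›
  have : Nonempty X := ⟨p⟩
  refine ⟨?_, fun S ε hε => ?_⟩
  · obtain ⟨l, hl, -⟩ := hX.exists_isAsymptoticWeight ∅ one_pos
    exact ⟨_, _, _, _, isRealisation_actionHom c hc hl p⟩
  · obtain ⟨l, hl, hS⟩ := hX.exists_isAsymptoticWeight S (half_pos hε)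
    refine ⟨_, _, _, _, isRealisation_actionHom c hc hl p, fun s hs => ?_⟩
    have h := abs_D_actionHom_sub_one_le c hc hl p (hS s hs)
    -- The bound ε/2 keeps the supremum strictly below ε. Boundedness is proved as well, since a
    -- real supremum over an unbounded set is 0 by convention.
    refine ⟨⟨ε / 2, ?_⟩, (ciSup_le h).trans_lt (half_lt_self hε)⟩
    rintro _ ⟨ξ, rfl⟩
    exact h ξ
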